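/- Let $X$ be a smooth compact $4$-manifold with boundary $M=\partial X$ and interior $X^\circ$, and let $g^+$ be a conformally compact Einstein metric on $X^\circ$: there is a smooth defining function $\rho$ of $M$ ($\rho>0$ in $X^\circ$, $\rho=0$ and $d\rho\neq0$ on $M$) such that $\rho^2g^+$ extends to a smooth Riemannian metric on $X$, and $\mathrm{Ric}_{g^+}=-3g^+$. Let $r$ be the geodesic defining function belonging to a representative $h$ of the conformal infinity: $r$ is a smooth defining function of $M$, $r^2g^+$ extends to a smooth Riemannian metric $\bar g$ on $X$ with $\bar g|_{TM}=h$, and $|dr|^2_{\bar g}=1$ in a neighbourhood of $M$. Let $w\in C^\infty(X^\circ)$ solve $-\Delta_{g^+}w=3$ on $X^\circ$. For a metric $g$ in dimension $4$ let $Q_g$ be defined by $$2Q_g=-\tfrac16\Delta_gR_g+\tfrac16\left(R_g^2-3|\mathrm{Ric}_g|_g^2\right),$$ and, if $g$ is smooth up to $M$, let $$T_g=\tfrac1{12}\partial_nR_g+\tfrac16R_gH-R_{\alpha n\beta n}L_{\alpha\beta}+\tfrac19H^3-\tfrac13\mathrm{Tr}\,L^3-\tfrac13\tilde\Delta H$$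 on $M$, where $n$ is the outward unit normal, $L$ the second fundamental form of $M$, $H=\mathrm{Tr}\,L$, $\tilde\Delta$ is the Laplacian of the metric induced on $M$, and the curvature tensor is normalised so that $R_{abab}>0$ on round spheres. Put $g^*=e^{2w}g^+$. Then: (a) $Q_{g^*}\equiv0$ on $X^\circ$. (b) Suppose that $w$ is normalised by the asymptotic behaviour $$w=\log r+A+Br^3\quad\text{near }M,$$ where $A$ and $B$ are smooth up to $M$ and even in $r$ (all derivatives of odd order with respect to $r$, taken along the flow of $\nabla_{\bar g}r$, vanish on $M$), and $A|_M=0$. Then $g^*$ extends to a Riemannian metric on $X$ that is smooth up to $M$, the boundary $M$ is totally geodesic for $g^*$ (that is, $L=0$), $Q_{g^*}\equiv0$ on $X$, and $$B|_M=\tfrac1{36}\,\partial_nR_{g^*}=\tfrac13\,T_{g^*}\quad\text{on }M.$$ -/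

import Mathlib

open Set
open scoped Manifold ContDiff Matrix

noncomputable section

namespace FGCompact

/-! ### Tensor calculus in local coordinates

A metric in local coordinates is a matrix-valued function `G` of `y ∈ ℝⁿ`.  Derivatives are taken
within a set `S`, which is a closed half-space for charts of a manifold with boundary (so that they
are one-sided in the normal direction at boundary points) and everything for charts of the
boundary. -/

section LocalCalculus

variable {n : ℕ}

/-- The partial derivative `∂ᵢ f`, taken within `S`. -/
def pd (S : Set (EuclideanSpace ℝ (Fin n))) (i : Fin n) (f : EuclideanSpace ℝ (Fin n) → ℝ)
    (y : EuclideanSpace ℝ (Fin n)) : ℝ :=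
  fderivWithin ℝ f S y (EuclideanSpace.single i 1)

variable (S : Set (EuclideanSpace ℝ (Fin n)))
  (G : EuclideanSpace ℝ (Fin n) → Matrix (Fin n) (Fin n) ℝ)

/-- The Christoffel symbols
`Γᵏᵢⱼ = ½ gᵏˡ (∂ᵢ gⱼₗ + ∂ⱼ gᵢₗ - ∂ₗ gᵢⱼ)`. -/
def christoffel (k i j : Fin n) (y : EuclideanSpace ℝ (Fin n)) : ℝ :=
  (1 / 2) * ∑ l, (G y)⁻¹ k l *
    (pd S i (fun z => G z j l) y + pd S j (fun z => G z i l) y - pd S l (fun z => G z i j) y)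

/-- The components `Rˡₖᵢⱼ` of the curvature tensor, `R(∂ᵢ, ∂ⱼ)∂ₖ = Rˡₖᵢⱼ ∂ₗ`, where
`R(U, V) = [∇_U, ∇_V] - ∇_[U, V]`. -/
def riemannUp (l k i j : Fin n) (y : EuclideanSpace ℝ (Fin n)) : ℝ :=
  pd S i (christoffel S G l j k) y - pd S j (christoffel S G l i k) y
    + ∑ m, (christoffel S G l i m y * christoffel S G m j k y
      - christoffel S G l j m y * christoffel S G m i k y)

/-- The covariant curvature tensor `R_{abcd} = g(R(∂ₐ, ∂_b)∂_d, ∂_c)`, normalised so that `R_{abab}`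
is positive on round spheres. -/
def riemann (a b c d : Fin n) (y : EuclideanSpace ℝ (Fin n)) : ℝ :=
  ∑ l, G y c l * riemannUp S G l d a b y

/-- The Ricci tensor `Ricⱼₖ = Rⁱₖᵢⱼ`. -/
def ricci (j k : Fin n) (y : EuclideanSpace ℝ (Fin n)) : ℝ :=
  ∑ i, riemannUp S G i k i j y

/-- The scalar curvature. -/
def scalarCurv (y : EuclideanSpace ℝ (Fin n)) : ℝ :=
  ∑ i, ∑ j, (G y)⁻¹ i j * ricci S G i j y

/-- The squared norm `|Ric|²`. -/
def ricciNormSq (y : EuclideanSpace ℝ (Fin n)) : ℝ :=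
  ∑ i, ∑ j, ∑ k, ∑ l, (G y)⁻¹ i k * (G y)⁻¹ j l * ricci S G i j y * ricci S G k l y

/-- The metric pairing of differentials `⟨dφ, df⟩ = gⁱʲ ∂ᵢφ ∂ⱼf`, which is also the derivative of
`f` along the gradient of `φ`. -/
def gradPair (φ f : EuclideanSpace ℝ (Fin n) → ℝ) (y : EuclideanSpace ℝ (Fin n)) : ℝ :=
  ∑ i, ∑ j, (G y)⁻¹ i j * pd S i φ y * pd S j f y

/-- The Laplace-Beltrami operator `Δf = gⁱʲ (∂ᵢ∂ⱼ f - Γᵏᵢⱼ ∂ₖ f)` (the trace of the Hessian). -/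
def laplacian (f : EuclideanSpace ℝ (Fin n) → ℝ) (y : EuclideanSpace ℝ (Fin n)) : ℝ :=
  ∑ i, ∑ j, (G y)⁻¹ i j *
    (pd S i (pd S j f) y - ∑ k, christoffel S G k i j y * pd S k f y)

end LocalCalculus

section Four

/-- The range of boundary charts in dimension four: the closed half-space `{y | 0 ≤ y 0}`. -/
abbrev halfSpace : Set (EuclideanSpace ℝ (Fin 4)) := range (𝓡∂ 4)

variable (G : EuclideanSpace ℝ (Fin 4) → Matrix (Fin 4) (Fin 4) ℝ)

/-- Branson's `Q`-curvature in dimension four: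
`2 Q = -(1/6) ΔR + (1/6) (R² - 3 |Ric|²)`. -/
def qCurv (y : EuclideanSpace ℝ (Fin 4)) : ℝ :=
  (1 / 2) * (-(1 / 6) * laplacian halfSpace G (scalarCurv halfSpace G) y
    + (1 / 6) * (scalarCurv halfSpace G y ^ 2 - 3 * ricciNormSq halfSpace G y))

/-- The outward unit normal to the boundary `{y 0 = 0}`: `ν = -∇y⁰ / |∇y⁰|`. -/
def outNormal (k : Fin 4) (y : EuclideanSpace ℝ (Fin 4)) : ℝ :=
  -((G y)⁻¹ k 0) / Real.sqrt ((G y)⁻¹ 0 0)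

/-- The derivative `∂f/∂n` in the direction of the outward unit normal. -/
def normalDeriv (f : EuclideanSpace ℝ (Fin 4) → ℝ) (y : EuclideanSpace ℝ (Fin 4)) : ℝ :=
  ∑ k, outNormal G k y * pd halfSpace k f y

/-- The second fundamental form of the boundary in the tangential coordinates `y¹, y², y³`:
`L_{αβ} = -g(ν, ∇_α ∂_β) = g(∇_α ν, ∂_β)`. -/
def secondForm (y : EuclideanSpace ℝ (Fin 4)) : Matrix (Fin 3) (Fin 3) ℝ :=
  Matrix.of fun α β =>
    -∑ k, ∑ l, G y k l * outNormal G k y * christoffel halfSpace G l α.succ β.succ y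

/-- The metric induced on the boundary, in the coordinates `y¹, y², y³`. -/
def tangMetric (y : EuclideanSpace ℝ (Fin 4)) : Matrix (Fin 3) (Fin 3) ℝ :=
  (G y).submatrix Fin.succ Fin.succ

/-- The shape operator, i.e. the second fundamental form with one index raised. -/
def shapeOp (y : EuclideanSpace ℝ (Fin 4)) : Matrix (Fin 3) (Fin 3) ℝ :=
  (tangMetric G y)⁻¹ * secondForm G y

/-- The mean curvature `H = Tr L`. -/
def meanCurv (y : EuclideanSpace ℝ (Fin 4)) : ℝ :=
  (shapeOp G y).trace

/-- The contraction `R_{αnβn} L_{αβ}`. -/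
def curvSecond (y : EuclideanSpace ℝ (Fin 4)) : ℝ :=
  ∑ α : Fin 3, ∑ β : Fin 3, ∑ γ : Fin 3, ∑ δ : Fin 3,
    (tangMetric G y)⁻¹ α γ * (tangMetric G y)⁻¹ β δ * secondForm G y γ δ *
      ∑ k, ∑ l, outNormal G k y * outNormal G l y * riemann halfSpace G α.succ k β.succ l y

/-- The inclusion `(z⁰, z¹, z²) ↦ (0, z⁰, z¹, z²)` of `ℝ³` as the boundary of the half-space. -/
def bdryIncl (z : EuclideanSpace ℝ (Fin 3)) : EuclideanSpace ℝ (Fin 4) :=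
  WithLp.toLp 2 (Fin.cons (0 : ℝ) fun α : Fin 3 => z α)

/-- The tangential coordinates of a point. -/
def tangCoord (y : EuclideanSpace ℝ (Fin 4)) : EuclideanSpace ℝ (Fin 3) :=
  WithLp.toLp 2 fun α : Fin 3 => y α.succ

/-- The intrinsic Laplacian of the boundary, applied to the mean curvature. -/
def bdryLaplacianMeanCurv (y : EuclideanSpace ℝ (Fin 4)) : ℝ :=
  laplacian univ (fun z => tangMetric G (bdryIncl z)) (fun z => meanCurv G (bdryIncl z))
    (tangCoord y)

/-- The `T`-curvature of the boundary:
`T = (1/12) ∂R/∂n + (1/6) R H - R_{αnβn} L_{αβ} + (1/9) H³ - (1/3) Tr L³ - (1/3) Δ̃H`. -/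
def tCurv (y : EuclideanSpace ℝ (Fin 4)) : ℝ :=
  (1 / 12) * normalDeriv G (scalarCurv halfSpace G) y
    + (1 / 6) * scalarCurv halfSpace G y * meanCurv G y
    - curvSecond G y + (1 / 9) * meanCurv G y ^ 3
    - (1 / 3) * (shapeOp G y ^ 3).trace - (1 / 3) * bdryLaplacianMeanCurv G y

end Four

/-! ### Four-manifolds with boundary -/

section Manifold

variable {X : Type*} [TopologicalSpace X] [ChartedSpace (EuclideanHalfSpace 4) X]

variable (X) in
/-- Fields of bilinear forms on the tangent spaces of `X` (no regularity, defined everywhere). -/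
abbrev BilinField : Type _ :=
  (x : X) → TangentSpace (𝓡∂ 4) x →L[ℝ] TangentSpace (𝓡∂ 4) x →L[ℝ] ℝ

variable (X) in
/-- Riemannian metrics on `X`, smooth up to the boundary. -/
abbrev SmoothMetric [IsManifold (𝓡∂ 4) ∞ X] : Type _ :=
  Bundle.ContMDiffRiemannianMetric (𝓡∂ 4) ∞ (EuclideanSpace ℝ (Fin 4))
    (fun x : X => TangentSpace (𝓡∂ 4) x)

/-- A function read in a chart `e`. -/
def coordFun (e : OpenPartialHomeomorph X (EuclideanHalfSpace 4)) (f : X → ℝ) :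
    EuclideanSpace ℝ (Fin 4) → ℝ :=
  fun y => f ((e.extend (𝓡∂ 4)).symm y)

/-- The coordinate vector field `∂ᵢ` of a chart `e`, at the point with coordinates `y`. -/
def coordVec (e : OpenPartialHomeomorph X (EuclideanHalfSpace 4)) (i : Fin 4)
    (y : EuclideanSpace ℝ (Fin 4)) : TangentSpace (𝓡∂ 4) ((e.extend (𝓡∂ 4)).symm y) :=
  mfderivWithin 𝓘(ℝ, EuclideanSpace ℝ (Fin 4)) (𝓡∂ 4) (e.extend (𝓡∂ 4)).symm halfSpace y
    (EuclideanSpace.single i (1 : ℝ) : EuclideanSpace ℝ (Fin 4))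

/-- The matrix `gᵢⱼ = g(∂ᵢ, ∂ⱼ)` of a field of bilinear forms in a chart `e`. -/
def coordMetric (e : OpenPartialHomeomorph X (EuclideanHalfSpace 4)) (g : BilinField X)
    (y : EuclideanSpace ℝ (Fin 4)) : Matrix (Fin 4) (Fin 4) ℝ :=
  Matrix.of fun i j => g ((e.extend (𝓡∂ 4)).symm y) (coordVec e i y) (coordVec e j y)

variable (X) in
/-- `e` is a (smoothly compatible) chart of `X`. -/
abbrev IsChart [IsManifold (𝓡∂ 4) ∞ X]
    (e : OpenPartialHomeomorph X (EuclideanHalfSpace 4)) : Prop :=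
  e ∈ IsManifold.maximalAtlas (𝓡∂ 4) ∞ X

variable [IsManifold (𝓡∂ 4) ∞ X]

/-- `r` is a defining function of the boundary: smooth on `X`, positive in the interior, zero on the
boundary, with nowhere vanishing differential on the boundary. -/
structure IsDefiningFunction (r : X → ℝ) : Prop where
  smooth : ContMDiff (𝓡∂ 4) 𝓘(ℝ, ℝ) ∞ r
  pos : ∀ x ∈ (𝓡∂ 4).interior X, 0 < r x
  zero : ∀ x ∈ (𝓡∂ 4).boundary X, r x = 0
  diff_ne_zero : ∀ x ∈ (𝓡∂ 4).boundary X, mfderiv (𝓡∂ 4) 𝓘(ℝ, ℝ) r x ≠ 0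

/-- `gbar` is the extension to `X` of `r² g⁺`, where `g⁺` is given in the interior only (its values
on the boundary are irrelevant). -/
def IsCompactification (gplus : BilinField X) (r : X → ℝ) (gbar : SmoothMetric X) : Prop :=
  ∀ x ∈ (𝓡∂ 4).interior X, gbar.inner x = (r x) ^ 2 • gplus x

/-- Conformally compact Einstein metrics `g⁺` in the interior of the (compact) four-manifold with
boundary `X`: some `r² g⁺` extends to a smooth metric on `X`, and `Ric = -3 g⁺`. -/
structure IsCCE (gplus : BilinField X) : Prop where
  conformallyCompact : ∃ (r : X → ℝ) (gbar : SmoothMetric X),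
    IsDefiningFunction r ∧ IsCompactification gplus r gbar
  einstein : ∀ p ∈ (𝓡∂ 4).interior X, ∀ e, IsChart X e → p ∈ e.source → ∀ i j : Fin 4,
    ricci halfSpace (coordMetric e gplus) i j (e.extend (𝓡∂ 4) p) =
      -3 * coordMetric e gplus (e.extend (𝓡∂ 4) p) i j

/-- `r` is the geodesic defining function of `g⁺` belonging to the representative `h = gbar|_M` of
the conformal infinity, where `gbar = r² g⁺`: `|dr|² = 1` with respect to `gbar` near the
boundary `M`. -/
structure IsGeodesicDefiningFunction (gplus : BilinField X) (r : X → ℝ) (gbar : SmoothMetric X) :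
    Prop where
  defining : IsDefiningFunction r
  compactification : IsCompactification gplus r gbar
  norm_diff : ∃ U : Set X, IsOpen U ∧ (𝓡∂ 4).boundary X ⊆ U ∧
    ∀ p ∈ U, ∀ e, IsChart X e → p ∈ e.source →
      gradPair halfSpace (coordMetric e gbar.inner) (coordFun e r) (coordFun e r)
        (e.extend (𝓡∂ 4) p) = 1

/-- `f` is even in `r`: all derivatives of odd order of `f` with respect to `r` vanish on the
boundary.  Here `∂/∂r` is the derivative along the gradient of `r` with respect to `gbar`, i.e. the
coordinate derivative in the collar `[0, ε) × M` which is given by the flow of this gradient. -/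
def IsEvenIn (gbar : SmoothMetric X) (r f : X → ℝ) : Prop :=
  ∀ p ∈ (𝓡∂ 4).boundary X, ∀ e, IsChart X e → p ∈ e.source → ∀ k : ℕ,
    (gradPair halfSpace (coordMetric e gbar.inner) (coordFun e r))^[2 * k + 1] (coordFun e f)
      (e.extend (𝓡∂ 4) p) = 0

/-- `w = log r + A + B r³` near the boundary `M`, where `A`, `B` are smooth up to the boundary and
even in `r`, and `A|_M = 0`. -/
structure HasExpansion (gbar : SmoothMetric X) (r w A B : X → ℝ) : Prop where
  expansion : ∃ U : Set X, IsOpen U ∧ (𝓡∂ 4).boundary X ⊆ U ∧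
    ContMDiffOn (𝓡∂ 4) 𝓘(ℝ, ℝ) ∞ A U ∧ ContMDiffOn (𝓡∂ 4) 𝓘(ℝ, ℝ) ∞ B U ∧
    ∀ x ∈ U ∩ (𝓡∂ 4).interior X, w x = Real.log (r x) + A x + B x * r x ^ 3
  even_A : IsEvenIn gbar r A
  even_B : IsEvenIn gbar r B
  zero_A : ∀ x ∈ (𝓡∂ 4).boundary X, A x = 0

/-- `w` is a smooth solution of `-Δ_{g⁺} w = 3` in the interior. -/
structure SolvesFG (gplus : BilinField X) (w : X → ℝ) : Prop where
  smooth : ContMDiffOn (𝓡∂ 4) 𝓘(ℝ, ℝ) ∞ w ((𝓡∂ 4).interior X)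
  eqn : ∀ p ∈ (𝓡∂ 4).interior X, ∀ e, IsChart X e → p ∈ e.source →
    -laplacian halfSpace (coordMetric e gplus) (coordFun e w) (e.extend (𝓡∂ 4) p) = 3

/-- The conformal metric `e^{2w} g`. -/
def conformal (w : X → ℝ) (g : BilinField X) : BilinField X :=
  fun x => Real.exp (2 * w x) • g x

/-- The boundary is totally geodesic: its second fundamental form vanishes. -/
def TotallyGeodesicBoundary (g : SmoothMetric X) : Prop :=
  ∀ p ∈ (𝓡∂ 4).boundary X, ∀ e, IsChart X e → p ∈ e.source →
    secondForm (coordMetric e g.inner) (e.extend (𝓡∂ 4) p) = 0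

/-- The `Q`-curvature of `g` at `p`, computed in the chart `e`. -/
def qCurvAt (e : OpenPartialHomeomorph X (EuclideanHalfSpace 4)) (g : BilinField X) (p : X) : ℝ :=
  qCurv (coordMetric e g) (e.extend (𝓡∂ 4) p)

/-- The outward normal derivative `∂R/∂n` of the scalar curvature of `g` at the boundary point `p`,
computed in the chart `e`. -/
def normalDerivScalarAt (e : OpenPartialHomeomorph X (EuclideanHalfSpace 4)) (g : BilinField X)
    (p : X) : ℝ :=
  normalDeriv (coordMetric e g) (scalarCurv halfSpace (coordMetric e g)) (e.extend (𝓡∂ 4) p)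

/-- The `T`-curvature of `g` at the boundary point `p`, computed in the chart `e`. -/
def tCurvAt (e : OpenPartialHomeomorph X (EuclideanHalfSpace 4)) (g : BilinField X) (p : X) : ℝ :=
  tCurv (coordMetric e g) (e.extend (𝓡∂ 4) p)

end Manifold

end FGCompact

end

/-! Vanishing of Q. In dimension four, `Ric = -3g` and `Δw = -3` make the zero-order terms of the
conformally transformed Ricci tensor cancel: with `f = |dw|²`, `Ric* = 2(dw⊗dw - ∇²w - f g)` and `R*
= 6e^{-2w}(1 - f)`. The only third derivatives of `w` in `ΔR*` come from `Δf`, and Bochner's formula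
turns them into `2|∇²w|² - 6f`. Then `-Δ*R* + R*² - 3|Ric*|²` vanishes identically
(`Alg.q_einstein_conformal`).

Boundary. Let `u = w - log r`, extended by zero, so that `u = A + Br³` near `M` and `g* = e^{2u}
gbar` is smooth on `X`. Since `|dr| = 1`, the Einstein equation becomes the regular equation `r Ric
+ 2∇²r + (Δr) gbar = 0` for `gbar`. At `r = 0` its trace gives `Δr = 0`, hence `∇²r = 0` and `M` is
totally geodesic for `gbar`. There `du = 0`: tangentially because `u = 0` on `M`, normally because
`A` is even. So `L = 0` for `g*` as well, and only the term `(1/12)∂_nR` of `T` survives.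

The formula for `R*` becomes `r R* = -6e^{-2u}(2⟨dr,du⟩ + r|du|²)`. Differentiating it twice along
`∇r` at `r = 0` leaves `2∂_rR* = -12 ∂_r³u = -72B`. As `∇r` is the inward unit normal, `∂_nR* = 36B`
(`Alg.gradDeriv_scalar`). Finally `Q = 0` reaches `M` by continuity and density of the interior.

The tensor identities are proved over an arbitrary commutative `ℝ`-algebra with commuting
derivations, where they are polynomial identities free of differentiability conditions. `Rep` and
`RepMetric` transport them to smooth functions on relatively open subsets of a half-space. All
assertions are proved chart by chart, so invariance of curvature under coordinate changes is never
needed. -/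

noncomputable section

namespace FGCompact

/-! ### Tensor calculus over a ring with commuting derivations -/

namespace Alg

variable {ι : Type*} [Fintype ι] [DecidableEq ι] {R : Type*} [CommRing R] [Algebra ℝ R]

/-- The Christoffel symbols of a metric `G` with inverse `I`. -/
def chr (D : ι → Derivation ℝ R R) (G I : ι → ι → R) (k i j : ι) : R :=
  algebraMap ℝ R (1 / 2) * ∑ l, I k l * (D i (G j l) + D j (G i l) - D l (G i j))

/-- The curvature of a connection. -/
def curv (D : ι → Derivation ℝ R R) (Γ : ι → ι → ι → R) (l k i j : ι) : R :=
  D i (Γ l j k) - D j (Γ l i k) + ∑ m, (Γ l i m * Γ m j k - Γ l j m * Γ m i k)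

/-- The Ricci curvature of a connection. -/
def ric (D : ι → Derivation ℝ R R) (Γ : ι → ι → ι → R) (j k : ι) : R :=
  ∑ i, curv D Γ i k i j

/-- The covariant derivative of a covector field. -/
def hess (D : ι → Derivation ℝ R R) (Γ : ι → ι → ι → R) (φ : ι → R) (i j : ι) : R :=
  D i (φ j) - ∑ k, Γ k i j * φ k

/-- The covariant derivative of a vector field. -/
def nab (D : ι → Derivation ℝ R R) (Γ : ι → ι → ι → R) (P : ι → R) (a i : ι) : R :=
  D a (P i) + ∑ m, Γ i a m * P m

/-- Raising an index. -/
def sharp (I : ι → ι → R) (φ : ι → R) (i : ι) : R := ∑ j, I i j * φ j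

/-- The trace of a bilinear form. -/
def tr (I : ι → ι → R) (h : ι → ι → R) : R := ∑ i, ∑ j, I i j * h i j

/-- The pairing of covectors. -/
def pair (I : ι → ι → R) (φ ψ : ι → R) : R := ∑ i, ∑ j, I i j * φ i * ψ j

/-- `G` is a metric with inverse `I` and the derivations `D` commute. -/
structure IsMetric (D : ι → Derivation ℝ R R) (G I : ι → ι → R) : Prop where
  comm : ∀ i j a, D i (D j a) = D j (D i a)
  symm : ∀ i j, G i j = G j i
  symm_inv : ∀ i j, I i j = I j i
  mul_inv : ∀ i j, ∑ l, G i l * I l j = if i = j then 1 else 0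

variable {D : ι → Derivation ℝ R R} {G I : ι → ι → R}

lemma half_add_half (a : R) : algebraMap ℝ R (1 / 2) * a + algebraMap ℝ R (1 / 2) * a = a := by
  rw [← two_mul, ← mul_assoc]
  have : (2 : R) * algebraMap ℝ R (1 / 2) = 1 := by
    have h2 : (2 : R) = algebraMap ℝ R 2 := (map_ofNat _ 2).symm
    rw [h2, ← map_mul]; norm_num
  rw [this, one_mul]

namespace IsMetric

variable (h : IsMetric D G I)
include h

lemma inv_mul (i j : ι) : ∑ l, I i l * G l j = if i = j then 1 else 0 := by
  have := h.mul_inv j i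
  rw [eq_comm] at this
  simp only [eq_comm (a := j)] at this
  rw [this]
  exact Finset.sum_congr rfl fun l _ => by rw [h.symm l j, h.symm_inv i l, mul_comm]

lemma chr_symm (k i j : ι) : chr D G I k i j = chr D G I k j i := by
  unfold chr
  congr 1
  refine Finset.sum_congr rfl fun l _ => ?_
  rw [h.symm i j]; ring

/-- Lowering the index of a raised covector. -/
lemma lower_sharp (φ : ι → R) (i : ι) : ∑ k, G i k * sharp I φ k = φ i := by
  unfold sharp
  simp only [Finset.mul_sum, ← mul_assoc]
  rw [Finset.sum_comm]
  simp only [← Finset.sum_mul, h.mul_inv]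
  simp

lemma lower_chr (m i j : ι) : ∑ k, G m k * chr D G I k i j =
    algebraMap ℝ R (1 / 2) * (D i (G j m) + D j (G i m) - D m (G i j)) := by
  have := h.lower_sharp (fun l => D i (G j l) + D j (G i l) - D l (G i j)) m
  simp only [sharp] at this
  conv_rhs => rw [← this]
  rw [Finset.mul_sum]
  exact Finset.sum_congr rfl fun k _ => by unfold chr; ring

/-- This is `∇G = 0`: in the sum of the two lowered Christoffel symbols the remaining derivatives
cancel, and `D k (G i j)` occurs twice with factor one half. -/
lemma compat (k i j : ι) :
    D k (G i j) = ∑ l, (G j l * chr D G I l k i + G i l * chr D G I l k j) := by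
  rw [Finset.sum_add_distrib, h.lower_chr, h.lower_chr, ← mul_add]
  rw [h.symm k i, h.symm k j, h.symm j i]
  have := half_add_half (R := R) (D k (G i j))
  rw [← mul_add] at this
  conv_lhs => rw [← this]
  congr 1; ring

/-- Differentiate `I G = 1`, insert `compat`, and solve by multiplying with `I` from the right. -/
lemma compat_inv (k i j : ι) :
    D k (I i j) = -∑ l, (chr D G I i k l * I l j + chr D G I j k l * I i l) := by
  have h1 : ∀ a, ∑ l, D k (I i l) * G l a =
      -∑ l, (∑ m, I i l * (G a m * chr D G I m k l + G l m * chr D G I m k a)) := by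
    intro a
    have := congrArg (D k) (h.inv_mul i a)
    have h0 : D k (if i = a then (1 : R) else 0) = 0 := by split_ifs <;> simp
    rw [h0, map_sum] at this
    simp only [Derivation.leibniz, smul_eq_mul, Finset.sum_add_distrib] at this
    rw [eq_neg_iff_add_eq_zero, ← this, add_comm]
    congr 1
    · refine Finset.sum_congr rfl fun l _ => ?_
      rw [h.compat k l a, Finset.mul_sum]
    · exact Finset.sum_congr rfl fun l _ => by ring
  have h2 : D k (I i j) = ∑ a, (∑ l, D k (I i l) * G l a) * I a j := by
    simp only [Finset.sum_mul, mul_assoc]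
    rw [Finset.sum_comm]
    simp only [← Finset.mul_sum, h.mul_inv]
    simp
  rw [h2]
  simp only [h1, neg_mul, Finset.sum_neg_distrib, Finset.sum_add_distrib, mul_add, add_mul]
  congr 1
  rw [add_comm]
  congr 1
  · have : ∀ a, ∑ l, ∑ m, I i l * (G l m * chr D G I m k a) = chr D G I i k a := by
      intro a
      rw [Finset.sum_comm]
      simp only [← mul_assoc, ← Finset.sum_mul, h.inv_mul]
      simp
    exact Finset.sum_congr rfl fun a _ => by rw [this]
  · have : ∀ l m, ∑ a, I i l * (G a m * chr D G I m k l) * I a j =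
        I i l * chr D G I m k l * (if m = j then 1 else 0) := by
      intro l m
      rw [← h.mul_inv, Finset.mul_sum]
      exact Finset.sum_congr rfl fun a _ => by rw [h.symm m a]; ring
    simp only [Finset.sum_mul]
    rw [Finset.sum_comm]
    refine Finset.sum_congr rfl fun l _ => ?_
    rw [Finset.sum_comm]
    simp only [this]
    simp [mul_comm]

/-- Raising an index commutes with `∇` because `∇I = 0`. Of the two Christoffel sums from
`compat_inv`, one cancels that of `nab` and the other is that of `hess`. -/
lemma nab_sharp (φ : ι → R) (a i : ι) :
    nab D (chr D G I) (sharp I φ) a i = ∑ j, I i j * hess D (chr D G I) φ a j := by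
  unfold nab sharp hess
  simp only [map_sum, Derivation.leibniz, smul_eq_mul, h.compat_inv, mul_sub, mul_neg,
    Finset.sum_add_distrib, Finset.sum_sub_distrib, Finset.sum_neg_distrib, mul_add, neg_add,
    Finset.mul_sum]
  have e1 : ∑ x, ∑ y, φ x * (chr D G I i a y * I y x) =
      ∑ x, ∑ y, chr D G I i a x * (I x y * φ y) := by
    rw [Finset.sum_comm]
    exact Finset.sum_congr rfl fun x _ => Finset.sum_congr rfl fun y _ => by ring
  have e2 : ∑ x, ∑ y, φ x * (chr D G I x a y * I i y) =
      ∑ x, ∑ y, I i x * (chr D G I y a x * φ y) := by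
    rw [Finset.sum_comm]
    exact Finset.sum_congr rfl fun x _ => Finset.sum_congr rfl fun y _ => by ring
  rw [e1, e2]; ring

/-- The Laplacian as the divergence of the gradient, the form in which `div_nab` applies. -/
lemma tr_hess (φ : ι → R) :
    tr I (hess D (chr D G I) φ) = ∑ i, nab D (chr D G I) (sharp I φ) i i := by
  unfold tr
  exact Finset.sum_congr rfl fun i _ => (h.nab_sharp φ i i).symm

omit h [DecidableEq ι] [Algebra ℝ R] in
lemma pair_eq (φ ψ : ι → R) : pair I φ ψ = ∑ i, φ i * sharp I ψ i := by
  unfold pair sharp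
  simp only [Finset.mul_sum]
  exact Finset.sum_congr rfl fun x _ => Finset.sum_congr rfl fun y _ => by ring

lemma pair_comm (φ ψ : ι → R) : pair I φ ψ = pair I ψ φ := by
  unfold pair
  rw [Finset.sum_comm]
  exact Finset.sum_congr rfl fun x _ => Finset.sum_congr rfl fun y _ => by
    rw [h.symm_inv]; ring

end IsMetric

omit [DecidableEq ι] in
/-- The divergence of `∇_P P` for a torsion-free connection. -/
lemma div_nab {Γ : ι → ι → ι → R} (hD : ∀ i j a, D i (D j a) = D j (D i a))
    (hΓ : ∀ k i j, Γ k i j = Γ k j i) (P : ι → R) :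
    ∑ i, nab D Γ (fun l => ∑ a, nab D Γ P a l * P a) i i =
      ∑ i, ∑ a, nab D Γ P a i * nab D Γ P i a + ∑ a, P a * D a (∑ i, nab D Γ P i i)
        + ∑ a, ∑ b, ric D Γ a b * P a * P b := by
  -- Interchanging `D i` and `D a` produces the derivative part of the Ricci tensor.
  have e : ∀ i a, D i (nab D Γ P a i) = D a (nab D Γ P i i) +
      ∑ b, (D i (Γ i a b) - D a (Γ i i b)) * P b + ∑ m, Γ i a m * D i (P m)
        - ∑ m, Γ i i m * D a (P m) := by
    intro i a
    simp only [nab, map_add, map_sum, Derivation.leibniz, smul_eq_mul, Finset.sum_add_distrib,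
      sub_mul, Finset.sum_sub_distrib, hD i a, mul_comm (P _)]
    ring
  -- Trading ordinary for covariant derivatives creates `∇P·∇P`; the corrections `ΓΓP` supply the
  -- quadratic part of the Ricci tensor.
  have dP : ∀ i m, D i (P m) = nab D Γ P i m - ∑ b, Γ m i b * P b := by
    intro i m; simp [nab]
  have lhs : ∑ i, nab D Γ (fun l => ∑ a, nab D Γ P a l * P a) i i =
      ∑ i, ∑ a, (nab D Γ P a i * D i (P a) + P a * D i (nab D Γ P a i)
        + ∑ m, Γ i i m * nab D Γ P a m * P a) := by
    refine Finset.sum_congr rfl fun i _ => ?_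
    rw [nab]
    simp only [map_sum, Derivation.leibniz, smul_eq_mul, Finset.mul_sum]
    rw [Finset.sum_comm, ← Finset.sum_add_distrib]
    refine Finset.sum_congr rfl fun a _ => ?_
    simp only [← mul_assoc]
  -- The only place where torsion-freeness enters.
  have e1 : ∑ i, ∑ a, ∑ b, nab D Γ P a i * (Γ a i b * P b) =
      ∑ i, ∑ a, ∑ m, P a * (Γ i a m * nab D Γ P i m) := by
    calc _ = ∑ a, ∑ i, ∑ b, nab D Γ P a i * (Γ a i b * P b) := Finset.sum_comm
      _ = ∑ a, ∑ b, ∑ i, nab D Γ P a i * (Γ a i b * P b) :=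
        Finset.sum_congr rfl fun _ _ => Finset.sum_comm
      _ = _ := Finset.sum_congr rfl fun a _ => Finset.sum_congr rfl fun b _ =>
        Finset.sum_congr rfl fun i _ => by rw [hΓ a i b]; ring
  have e2 : ∑ a, ∑ b, ric D Γ a b * P a * P b = ∑ i, ∑ a, ∑ b, P a * ((D i (Γ i a b)
      - D a (Γ i i b) + ∑ m, (Γ i i m * Γ m a b - Γ i a m * Γ m i b)) * P b) := by
    conv_rhs => rw [Finset.sum_comm]
    refine Finset.sum_congr rfl fun a _ => ?_
    conv_rhs => rw [Finset.sum_comm]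
    refine Finset.sum_congr rfl fun b _ => ?_
    rw [ric, Finset.sum_mul, Finset.sum_mul]
    unfold curv
    exact Finset.sum_congr rfl fun i _ => by ring
  have e3 : ∑ a, P a * D a (∑ i, nab D Γ P i i) = ∑ i, ∑ a, P a * D a (nab D Γ P i i) := by
    rw [Finset.sum_comm]
    simp only [map_sum, Finset.mul_sum]
  have e4 : ∀ i a, ∑ b, P a * ((D i (Γ i a b) - D a (Γ i i b)
      + ∑ m, (Γ i i m * Γ m a b - Γ i a m * Γ m i b)) * P b) =
      P a * ∑ b, (D i (Γ i a b) - D a (Γ i i b)) * P b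
        + P a * ∑ m, Γ i i m * ∑ b, Γ m a b * P b
        - P a * ∑ m, Γ i a m * ∑ b, Γ m i b * P b := by
    intro i a
    simp only [Finset.mul_sum, add_mul, mul_add, Finset.sum_add_distrib, Finset.sum_mul, sub_mul,
      mul_sub, Finset.sum_sub_distrib, mul_assoc]
    rw [Finset.sum_comm (f := fun m b => P a * (Γ i i m * (Γ m a b * P b))),
      Finset.sum_comm (f := fun m b => P a * (Γ i a m * (Γ m i b * P b)))]
    ring
  rw [lhs, e2, e3]
  simp only [e4, e]
  simp only [dP]
  rw [← sub_eq_zero] at e1 ⊢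
  rw [← neg_eq_zero, ← e1]
  simp only [← Finset.sum_add_distrib, ← Finset.sum_sub_distrib, ← Finset.sum_neg_distrib]
  refine Finset.sum_congr rfl fun i _ => Finset.sum_congr rfl fun a _ => ?_
  simp only [mul_sub, mul_add, Finset.sum_sub_distrib, Finset.mul_sum]
  rw [show ∑ m, Γ i i m * nab D Γ P a m * P a = ∑ m, P a * (Γ i i m * nab D Γ P a m) from
    Finset.sum_congr rfl fun m _ => by ring]
  ring

end Alg
end FGCompact

/-! ### Bochner's formula and conformal change of curvature -/

namespace FGCompact
namespace Alg

variable {ι : Type*} [Fintype ι] [DecidableEq ι] {R : Type*} [CommRing R] [Algebra ℝ R]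
  {D : ι → Derivation ℝ R R} {G I : ι → ι → R}

/-- The inner product of bilinear forms. -/
def ip (I : ι → ι → R) (h h' : ι → ι → R) : R :=
  ∑ i, ∑ j, ∑ k, ∑ l, I i k * I j l * h i j * h' k l

/-- The evaluation `h(φ♯, φ♯)`. -/
def evalSharp (I : ι → ι → R) (h : ι → ι → R) (φ : ι → R) : R :=
  ∑ a, ∑ b, h a b * sharp I φ a * sharp I φ b

namespace IsMetric

variable (h : IsMetric D G I)
include h

lemma hess_symm {φ : ι → R} (hφ : ∀ i j, D i (φ j) = D j (φ i)) (i j : ι) :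
    hess D (chr D G I) φ i j = hess D (chr D G I) φ j i := by
  unfold hess
  rw [hφ]; congr 1
  exact Finset.sum_congr rfl fun k _ => by rw [h.chr_symm]

/-- The derivative of `|φ|²`. -/
lemma deriv_pair_self (φ : ι → R) (j : ι) :
    D j (pair I φ φ) = 2 * ∑ a, hess D (chr D G I) φ j a * sharp I φ a := by
  have e1 : ∀ a, D j (φ a) = hess D (chr D G I) φ j a + ∑ k, chr D G I k j a * φ k := by
    intro a; simp [hess]
  have e2 : ∀ a, D j (sharp I φ a) = ∑ b, I a b * hess D (chr D G I) φ j b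
      - ∑ m, chr D G I a j m * sharp I φ m := by
    intro a; rw [← h.nab_sharp]; simp [nab]
  rw [pair_eq]
  simp only [map_sum, Derivation.leibniz, smul_eq_mul, e1, e2, Finset.sum_add_distrib, mul_sub,
    mul_add, Finset.sum_sub_distrib, Finset.mul_sum]
  have e3 : ∑ a, ∑ b, φ a * (I a b * hess D (chr D G I) φ j b) =
      ∑ a, sharp I φ a * hess D (chr D G I) φ j a := by
    rw [Finset.sum_comm]
    refine Finset.sum_congr rfl fun b _ => ?_
    rw [sharp, Finset.sum_mul]
    exact Finset.sum_congr rfl fun a _ => by rw [h.symm_inv a b]; ring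
  have e4 : ∑ a, ∑ b, φ a * (chr D G I a j b * sharp I φ b) =
      ∑ a, ∑ b, sharp I φ a * (chr D G I b j a * φ b) := by
    rw [Finset.sum_comm]
    exact Finset.sum_congr rfl fun b _ => Finset.sum_congr rfl fun a _ => by ring
  rw [e3, e4, ← Finset.mul_sum, show ∑ a, hess D (chr D G I) φ j a * sharp I φ a =
    ∑ a, sharp I φ a * hess D (chr D G I) φ j a from Finset.sum_congr rfl fun _ _ => mul_comm _ _]
  ring

lemma pair_deriv_pair_self (φ : ι → R) :
    pair I φ (fun j => D j (pair I φ φ)) = 2 * evalSharp I (hess D (chr D G I) φ) φ := by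
  rw [h.pair_comm, pair_eq, evalSharp, Finset.mul_sum]
  refine Finset.sum_congr rfl fun j _ => ?_
  rw [h.deriv_pair_self, mul_assoc, Finset.sum_mul]
  congr 1
  exact Finset.sum_congr rfl fun a _ => by ring

/-- For closed `φ` the Hessian is symmetric, so the gradient of `|φ|²` is `2∇_P P` with `P = φ♯`;
this reduces Bochner's formula to `div_nab`. -/
lemma sharp_deriv_pair_self {φ : ι → R} (hφ : ∀ i j, D i (φ j) = D j (φ i)) :
    sharp I (fun j => D j (pair I φ φ)) =
      fun l => 2 * ∑ a, nab D (chr D G I) (sharp I φ) a l * sharp I φ a := by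
  funext l
  simp only [sharp, h.deriv_pair_self]
  change ∑ j, I l j * (2 * ∑ a, _ * sharp I φ a) = 2 * ∑ a, nab D _ (sharp I φ) a l * sharp I φ a
  simp only [h.nab_sharp, Finset.mul_sum, Finset.sum_mul]
  rw [Finset.sum_comm]
  exact Finset.sum_congr rfl fun a _ => Finset.sum_congr rfl fun j _ => by
    rw [h.hess_symm hφ j a]; ring

/-- Bochner's formula. -/
lemma bochner {φ : ι → R} (hφ : ∀ i j, D i (φ j) = D j (φ i)) :
    tr I (hess D (chr D G I) fun j => D j (pair I φ φ)) =
      2 * ip I (hess D (chr D G I) φ) (hess D (chr D G I) φ)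
        + 2 * pair I (fun a => D a (tr I (hess D (chr D G I) φ))) φ
        + 2 * evalSharp I (ric D (chr D G I)) φ := by
  rw [h.tr_hess, h.sharp_deriv_pair_self hφ]
  have e1 : ∀ P : ι → R, ∑ i, nab D (chr D G I) (fun l => 2 * P l) i i =
      2 * ∑ i, nab D (chr D G I) P i i := by
    intro P
    rw [Finset.mul_sum]
    refine Finset.sum_congr rfl fun i _ => ?_
    have h2 : D i (2 : R) = 0 := by simpa using (D i).map_natCast 2
    simp only [nab, Derivation.leibniz, smul_eq_mul, h2, mul_add, Finset.mul_sum, mul_zero, add_zero]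
    congr 1
    exact Finset.sum_congr rfl fun _ _ => by ring
  rw [e1, div_nab h.comm h.chr_symm, mul_add, mul_add]
  congr 2
  -- Symmetry of the Hessian identifies the contraction `∇_aPⁱ ∇_iPᵃ` with the squared norm of `∇φ`.
  · congr 1
    simp only [h.nab_sharp, ip, Finset.mul_sum, Finset.sum_mul]
    refine Finset.sum_congr rfl fun i _ => ?_
    calc _ = ∑ a, ∑ l, ∑ j, I i j * hess D (chr D G I) φ a j * (I a l * hess D (chr D G I) φ i l) :=
          Finset.sum_congr rfl fun _ _ => by rw [Finset.sum_comm]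
      _ = ∑ l, ∑ a, ∑ j, I i j * hess D (chr D G I) φ a j * (I a l * hess D (chr D G I) φ i l) :=
          Finset.sum_comm
      _ = ∑ l, ∑ j, ∑ a, I i j * hess D (chr D G I) φ a j * (I a l * hess D (chr D G I) φ i l) :=
          Finset.sum_congr rfl fun _ _ => Finset.sum_comm
      _ = _ := Finset.sum_congr rfl fun l _ => Finset.sum_congr rfl fun j _ =>
          Finset.sum_congr rfl fun a _ => by rw [h.symm_inv a l, h.hess_symm hφ a j]; ring
  · rw [← h.tr_hess, pair_eq]
    congr 1
    exact Finset.sum_congr rfl fun _ _ => mul_comm _ _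

end IsMetric

section Conformal

variable {E E' : R} {φ : ι → R}

/-- A general ring has no exponential, so the conformal factor is a unit `E` with inverse `E'`. In
the lemmas below the relation `D i E = 2 * E * φ i` expresses `E = e^{2f}` with `φ = df`. -/
lemma IsMetric.conformal (h : IsMetric D G I) (hE : E * E' = 1) :
    IsMetric D (fun i j => E * G i j) (fun i j => E' * I i j) where
  comm := h.comm
  symm i j := by rw [h.symm]
  symm_inv i j := by rw [h.symm_inv]
  mul_inv i j := by
    rw [← h.mul_inv]
    exact Finset.sum_congr rfl fun l _ => by
      linear_combination (G i l * I l j) * hE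

/-- The Christoffel symbols of a conformal metric. -/
lemma IsMetric.chr_conformal (h : IsMetric D G I) (hE : E * E' = 1)
    (hφ : ∀ i, D i E = 2 * E * φ i) (k i j : ι) :
    chr D (fun i j => E * G i j) (fun i j => E' * I i j) k i j = chr D G I k i j +
      ((if k = j then φ i else 0) + (if k = i then φ j else 0) - G i j * sharp I φ k) := by
  -- The Kronecker deltas are written as `I G`, so that both sides become one sum over `l` and can
  -- be compared termwise.
  have e1 : ∀ j, (if k = j then (1 : R) else 0) = ∑ l, I k l * G j l := by
    intro j; rw [← h.inv_mul]; exact Finset.sum_congr rfl fun l _ => by rw [h.symm]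
  have e2 : ∀ j a, (if k = j then a else 0) = a * ∑ l, I k l * G j l := by
    intro j a; rw [← e1]; simp
  have e3 : ∀ a : R, a = algebraMap ℝ R (1 / 2) * (2 * a) := by
    intro a; rw [two_mul, mul_add, half_add_half]
  rw [e2, e2]
  conv_rhs => rw [e3 (φ i * _ + _ - _)]
  rw [chr, chr, ← mul_add]
  congr 1
  simp only [sharp, Finset.mul_sum, ← Finset.sum_add_distrib, ← Finset.sum_sub_distrib]
  refine Finset.sum_congr rfl fun l _ => ?_
  simp only [Derivation.leibniz, smul_eq_mul, hφ]
  linear_combination (I k l * (D i (G j l) + D j (G i l) - D l (G i j)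
    + 2 * (φ i * G j l + φ j * G i l - φ l * G i j))) * hE

/-- The Hessian with respect to a conformal metric. -/
lemma IsMetric.hess_conformal (h : IsMetric D G I) (hE : E * E' = 1)
    (hφ : ∀ i, D i E = 2 * E * φ i) (ψ : ι → R) (i j : ι) :
    hess D (chr D (fun i j => E * G i j) (fun i j => E' * I i j)) ψ i j =
      hess D (chr D G I) ψ i j - (φ i * ψ j + φ j * ψ i - G i j * pair I φ ψ) := by
  simp only [hess, h.chr_conformal hE hφ, add_mul, sub_mul, ite_mul, zero_mul,
    Finset.sum_add_distrib, Finset.sum_sub_distrib, Finset.sum_ite_eq', Finset.mem_univ, if_true]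
  rw [h.pair_comm, IsMetric.pair_eq, Finset.mul_sum]
  rw [show ∑ x, G i j * sharp I φ x * ψ x = ∑ x, G i j * (ψ x * sharp I φ x) from
    Finset.sum_congr rfl fun _ _ => by ring]
  ring

lemma IsMetric.tr_metric (h : IsMetric D G I) : tr I G = (Fintype.card ι : R) := by
  unfold tr
  have : ∀ i, ∑ j, I i j * G i j = 1 := fun i => by
    have := h.inv_mul i i
    rw [if_pos rfl] at this
    rw [← this]; exact Finset.sum_congr rfl fun l _ => by rw [h.symm]
  simp [this]

omit [DecidableEq ι] [Algebra ℝ R] in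
lemma tr_mul_left (c : R) (a : ι → ι → R) : tr I (fun i j => c * a i j) = c * tr I a := by
  simp only [tr, Finset.mul_sum]
  exact Finset.sum_congr rfl fun _ _ => Finset.sum_congr rfl fun _ _ => by ring

omit [DecidableEq ι] [Algebra ℝ R] in
lemma tr_add (a b : ι → ι → R) : tr I (fun i j => a i j + b i j) = tr I a + tr I b := by
  simp only [tr, mul_add, Finset.sum_add_distrib]

omit [DecidableEq ι] [Algebra ℝ R] in
lemma tr_sub (a b : ι → ι → R) : tr I (fun i j => a i j - b i j) = tr I a - tr I b := by
  simp only [tr, mul_sub, Finset.sum_sub_distrib]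

omit [DecidableEq ι] [Algebra ℝ R] in
lemma tr_tensor (φ ψ : ι → R) : tr I (fun i j => φ i * ψ j) = pair I φ ψ := by
  simp only [tr, pair, mul_assoc]

omit [DecidableEq ι] [Algebra ℝ R] in
lemma tr_inv_mul_left (c : R) (a : ι → ι → R) : tr (fun i j => c * I i j) a = c * tr I a := by
  simp only [tr, Finset.mul_sum]
  exact Finset.sum_congr rfl fun _ _ => Finset.sum_congr rfl fun _ _ => by ring

/-- The Laplacian of a conformal metric. -/
lemma IsMetric.lap_conformal (h : IsMetric D G I) (hE : E * E' = 1)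
    (hφ : ∀ i, D i E = 2 * E * φ i) (ψ : ι → R) :
    tr (fun i j => E' * I i j)
        (hess D (chr D (fun i j => E * G i j) (fun i j => E' * I i j)) ψ) =
      E' * (tr I (hess D (chr D G I) ψ) + (Fintype.card ι - 2) * pair I φ ψ) := by
  rw [tr_inv_mul_left]
  congr 1
  have e : tr I (hess D (chr D (fun i j => E * G i j) (fun i j => E' * I i j)) ψ) =
      tr I (hess D (chr D G I) ψ) - (pair I φ ψ + pair I ψ φ - pair I φ ψ * tr I G) := by
    rw [show hess D (chr D (fun i j => E * G i j) (fun i j => E' * I i j)) ψ = fun i j =>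
      hess D (chr D G I) ψ i j - (φ i * ψ j + φ j * ψ i - pair I φ ψ * G i j) from by
        funext i j; rw [h.hess_conformal hE hφ]; ring]
    rw [tr_sub, tr_sub, tr_add, tr_mul_left, tr_tensor]
    rw [show (fun i j => φ j * ψ i) = fun i j => ψ i * φ j from by funext i j; ring, tr_tensor]
  rw [e, h.pair_comm ψ, h.tr_metric]; ring

/-- The Ricci curvature of a conformal metric. -/
lemma IsMetric.ric_conformal (h : IsMetric D G I) (hE : E * E' = 1)
    (hφ : ∀ i, D i E = 2 * E * φ i) (hcl : ∀ i j, D i (φ j) = D j (φ i)) (j k : ι) :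
    ric D (chr D (fun i j => E * G i j) (fun i j => E' * I i j)) j k = ric D (chr D G I) j k
      - (Fintype.card ι - 2) * (hess D (chr D G I) φ j k - φ j * φ k)
      - (tr I (hess D (chr D G I) φ) + (Fintype.card ι - 2) * pair I φ φ) * G j k := by
  set Γ := chr D G I with hΓ
  set P := sharp I φ with hP
  set F : ι → ι → ι → R := fun l j k => Γ l j k +
      ((if l = k then φ j else 0) + (if l = j then φ k else 0) - G j k * P l) with hF
  have hchr : chr D (fun i j => E * G i j) (fun i j => E' * I i j) = F := by
    funext l j k; rw [h.chr_conformal hE hφ]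
  have hlow : ∀ k, ∑ i, G i k * P i = φ k := fun k => by
    rw [← h.lower_sharp φ k]; exact Finset.sum_congr rfl fun i _ => by rw [h.symm]
  -- The difference tensor has trace `φ + nφ - φ = nφ`.
  have htr : ∀ k, ∑ i, F i i k = ∑ i, Γ i i k + Fintype.card ι * φ k := by
    intro k
    simp [hF, Finset.sum_add_distrib, hlow]
  have hpair : pair I φ φ = ∑ m, φ m * P m := IsMetric.pair_eq _ _
  -- `s1` to `s4` compute the four groups of terms in the contracted curvature of `F`: two with
  -- derivatives, two quadratic.
  have s1 : ∑ i, D i (F i j k) = ∑ i, D i (Γ i j k) + D k (φ j) + D j (φ k)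
      - ∑ i, D i (G j k) * P i - G j k * ∑ i, D i (P i) := by
    have e : ∀ (p : Prop) [Decidable p] (i : ι) (a : R), D i (if p then a else 0) =
      if p then D i a else 0 := by intro p _ i a; split_ifs <;> simp
    simp only [hF, map_add, map_sub, Derivation.leibniz, smul_eq_mul, Finset.sum_add_distrib,
      Finset.sum_sub_distrib, e, Finset.sum_ite_eq', Finset.mem_univ, if_true, ← Finset.mul_sum]
    rw [show ∑ i, P i * D i (G j k) = ∑ i, D i (G j k) * P i from
      Finset.sum_congr rfl fun _ _ => mul_comm _ _]
    ring
  have s2 : ∑ i, D j (F i i k) = ∑ i, D j (Γ i i k) + Fintype.card ι * D j (φ k) := by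
    rw [← map_sum, htr, map_add, map_sum]
    simp
  have s3 : ∑ i, ∑ m, F i i m * F m j k = ∑ i, ∑ m, Γ i i m * Γ m j k
      + Fintype.card ι * ∑ m, φ m * Γ m j k + φ j * ∑ i, Γ i i k + φ k * ∑ i, Γ i i j
      + 2 * Fintype.card ι * (φ j * φ k) - G j k * ∑ i, ∑ m, Γ i i m * P m
      - Fintype.card ι * G j k * ∑ m, φ m * P m := by
    have e : ∀ a : ι → R, ∑ m, a m * F m j k =
        ∑ m, a m * Γ m j k + a k * φ j + a j * φ k - G j k * ∑ m, a m * P m := by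
      intro a
      simp only [hF, mul_add, mul_sub, Finset.sum_add_distrib, Finset.sum_sub_distrib, mul_ite,
        mul_zero, Finset.sum_ite_eq', Finset.mem_univ, if_true, Finset.mul_sum]
      rw [show ∑ i, a i * (G j k * P i) = ∑ i, G j k * (a i * P i) from
        Finset.sum_congr rfl fun _ _ => by ring]
      ring
    rw [Finset.sum_comm]
    simp only [← Finset.sum_mul, htr]
    rw [e]
    simp only [add_mul, Finset.sum_add_distrib, Finset.sum_mul, mul_assoc, ← Finset.mul_sum]
    rw [Finset.sum_comm (f := fun m i => Γ i i m * Γ m j k),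
      Finset.sum_comm (f := fun m i => Γ i i m * P m),
      ← Finset.sum_mul, ← Finset.sum_mul]
    ring
  have s4 : ∑ i, ∑ m, F i j m * F m i k = ∑ i, ∑ m, Γ i j m * Γ m i k
      + 2 * ∑ m, φ m * Γ m j k + φ k * ∑ i, Γ i j i + φ j * ∑ i, Γ i i k
      - ∑ i, ∑ m, Γ i j m * (G i k * P m) - ∑ i, ∑ m, G j m * P i * Γ m i k
      + (Fintype.card ι + 2) * (φ j * φ k) - 2 * G j k * ∑ m, φ m * P m := by
    have hite : ∀ (p : Prop) [Decidable p] (a b : R),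
        (if p then a else 0) * b = if p then a * b else 0 := fun p _ a b => by split_ifs <;> simp
    have e1 : ∀ i, ∑ m, Γ i j m * F m i k = ∑ m, Γ i j m * Γ m i k + Γ i j k * φ i
        + Γ i j i * φ k - ∑ m, Γ i j m * (G i k * P m) := by
      intro i
      simp only [hF, mul_add, mul_sub, Finset.sum_add_distrib, Finset.sum_sub_distrib, mul_ite,
        mul_zero, Finset.sum_ite_eq', Finset.mem_univ, if_true]
      ring
    have e2 : ∑ m, φ m * F m j k = ∑ m, φ m * Γ m j k + 2 * (φ j * φ k)
        - G j k * ∑ m, φ m * P m := by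
      simp only [hF, mul_add, mul_sub, Finset.sum_add_distrib, Finset.sum_sub_distrib, mul_ite,
        mul_zero, Finset.sum_ite_eq', Finset.mem_univ, if_true, Finset.mul_sum]
      rw [show ∑ i, φ i * (G j k * P i) = ∑ i, G j k * (φ i * P i) from
        Finset.sum_congr rfl fun _ _ => by ring]
      ring
    have e3 : ∀ i, ∑ m, G j m * F m i k = ∑ m, G j m * Γ m i k + G j k * φ i + G j i * φ k
        - G i k * φ j := by
      intro i
      have : ∑ m, G j m * (G i k * P m) = G i k * φ j := by
        rw [← h.lower_sharp φ j, Finset.mul_sum]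
        exact Finset.sum_congr rfl fun _ _ => by ring
      simp only [hF, mul_add, mul_sub, Finset.sum_add_distrib, Finset.sum_sub_distrib, mul_ite,
        mul_zero, Finset.sum_ite_eq', Finset.mem_univ, if_true, this]
      ring
    have e4 : ∀ i, ∑ m, F i j m * F m i k = ∑ m, Γ i j m * F m i k + φ j * F i i k
        + (if i = j then ∑ m, φ m * F m i k else 0) - P i * ∑ m, G j m * F m i k := by
      intro i
      have : ∀ m, F i j m = Γ i j m + ((if i = m then φ j else 0) + (if i = j then φ m else 0)
        - G j m * P i) := fun _ => rfl
      simp only [this, add_mul, sub_mul, Finset.sum_add_distrib, Finset.sum_sub_distrib, hite,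
        Finset.sum_ite_eq, Finset.mem_univ, if_true, Finset.mul_sum]
      rw [show ∑ m, G j m * P i * F m i k = ∑ m, P i * (G j m * F m i k) from
        Finset.sum_congr rfl fun _ _ => by ring]
      split_ifs <;> (try simp only [Finset.sum_const_zero]) <;> ring
    simp only [e4, e1, e3, Finset.sum_add_distrib, Finset.sum_sub_distrib, Finset.sum_ite_eq',
      Finset.mem_univ, if_true, e2, ← Finset.mul_sum, htr, mul_add, mul_sub]
    have e5 : ∑ i, P i * (G j k * φ i) = G j k * ∑ m, φ m * P m := by
      rw [Finset.mul_sum]; exact Finset.sum_congr rfl fun _ _ => by ring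
    have e6 : ∑ i, P i * (G j i * φ k) = φ j * φ k := by
      rw [← h.lower_sharp φ j, Finset.sum_mul]; exact Finset.sum_congr rfl fun _ _ => by ring
    have e7 : ∑ i, P i * (G i k * φ j) = φ j * φ k := by
      rw [← hlow k, Finset.mul_sum]; exact Finset.sum_congr rfl fun _ _ => by ring
    have e8 : ∑ i, P i * ∑ m, G j m * Γ m i k = ∑ i, ∑ m, G j m * P i * Γ m i k := by
      simp only [Finset.mul_sum]
      exact Finset.sum_congr rfl fun _ _ => Finset.sum_congr rfl fun _ _ => by ring
    rw [e5, e6, e7, e8, ← Finset.sum_mul, show ∑ m, φ m * Γ m j k = ∑ m, Γ m j k * φ m from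
      Finset.sum_congr rfl fun _ _ => mul_comm _ _,
      show ∑ i, Γ i j k * φ i = ∑ m, Γ m j k * φ m from rfl]
    ring
  -- Metric compatibility makes the derivative of `G` in `s1` cancel the mixed terms of `s4`.
  have s5 : ∑ i, D i (G j k) * P i = ∑ i, ∑ m, Γ i j m * (G i k * P m)
      + ∑ i, ∑ m, G j m * P i * Γ m i k := by
    simp only [h.compat, ← hΓ, add_mul, Finset.sum_mul, Finset.sum_add_distrib]
    congr 1
    · rw [Finset.sum_comm]
      exact Finset.sum_congr rfl fun _ _ => Finset.sum_congr rfl fun _ _ => by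
        rw [hΓ, h.chr_symm, h.symm k]; ring
    · exact Finset.sum_congr rfl fun _ _ => Finset.sum_congr rfl fun _ _ => by ring
  have s6 : tr I (hess D Γ φ) = ∑ i, D i (P i) + ∑ i, ∑ m, Γ i i m * P m := by
    rw [h.tr_hess]; simp only [nab, Finset.sum_add_distrib]; rfl
  rw [hchr, ric, ric]
  simp only [curv, Finset.sum_add_distrib, Finset.sum_sub_distrib]
  rw [s1, s2, s3, s4, s5, s6, hpair, hess, hcl k j,
    show ∑ i, Γ i j i = ∑ i, Γ i i j from Finset.sum_congr rfl fun _ _ => h.chr_symm _ _ _,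
    show ∑ m, φ m * Γ m j k = ∑ m, Γ m j k * φ m from Finset.sum_congr rfl fun _ _ => mul_comm _ _]
  ring


end Conformal

end Alg
end FGCompact

/-! ### The Q-curvature of a metric conformal to an Einstein metric -/

namespace FGCompact
namespace Alg

variable {ι : Type*} [Fintype ι] {R : Type*} [CommRing R]
  {I : ι → ι → R}

lemma ip_sub_left (a b c : ι → ι → R) :
    ip I (fun i j => a i j - b i j) c = ip I a c - ip I b c := by
  simp only [ip, mul_sub, sub_mul, Finset.sum_sub_distrib]

lemma ip_mul_left (r : R) (a c : ι → ι → R) : ip I (fun i j => r * a i j) c = r * ip I a c := by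
  simp only [ip, Finset.mul_sum]
  exact Finset.sum_congr rfl fun _ _ => Finset.sum_congr rfl fun _ _ =>
    Finset.sum_congr rfl fun _ _ => Finset.sum_congr rfl fun _ _ => by ring

lemma ip_sub_right (a b c : ι → ι → R) :
    ip I c (fun i j => a i j - b i j) = ip I c a - ip I c b := by
  simp only [ip, mul_sub, Finset.sum_sub_distrib]

lemma ip_mul_right (r : R) (a c : ι → ι → R) : ip I c (fun i j => r * a i j) = r * ip I c a := by
  simp only [ip, Finset.mul_sum]
  exact Finset.sum_congr rfl fun _ _ => Finset.sum_congr rfl fun _ _ =>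
    Finset.sum_congr rfl fun _ _ => Finset.sum_congr rfl fun _ _ => by ring

lemma ip_comm (hI : ∀ i j, I i j = I j i) (a b : ι → ι → R) : ip I a b = ip I b a := by
  unfold ip
  calc _ = ∑ i, ∑ k, ∑ j, ∑ l, I i k * I j l * a i j * b k l :=
        Finset.sum_congr rfl fun _ _ => Finset.sum_comm
    _ = ∑ k, ∑ i, ∑ j, ∑ l, I i k * I j l * a i j * b k l := Finset.sum_comm
    _ = ∑ k, ∑ i, ∑ l, ∑ j, I i k * I j l * a i j * b k l :=
        Finset.sum_congr rfl fun _ _ => Finset.sum_congr rfl fun _ _ => Finset.sum_comm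
    _ = ∑ k, ∑ l, ∑ i, ∑ j, I i k * I j l * a i j * b k l :=
        Finset.sum_congr rfl fun _ _ => Finset.sum_comm
    _ = _ := Finset.sum_congr rfl fun k _ => Finset.sum_congr rfl fun l _ =>
        Finset.sum_congr rfl fun i _ => Finset.sum_congr rfl fun j _ => by
          rw [hI i k, hI j l]; ring

lemma ip_inv_mul_left (c : R) (a b : ι → ι → R) :
    ip (fun i j => c * I i j) a b = c ^ 2 * ip I a b := by
  simp only [ip, Finset.mul_sum]
  exact Finset.sum_congr rfl fun _ _ => Finset.sum_congr rfl fun _ _ =>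
    Finset.sum_congr rfl fun _ _ => Finset.sum_congr rfl fun _ _ => by ring

lemma ip_tensor_right (h : ι → ι → R) (φ : ι → R) :
    ip I h (fun i j => φ i * φ j) = evalSharp I h φ := by
  simp only [ip, evalSharp, sharp, mul_assoc, Finset.mul_sum, Finset.sum_mul]
  refine Finset.sum_congr rfl fun _ _ => Finset.sum_congr rfl fun _ _ => ?_
  rw [Finset.sum_comm]
  exact Finset.sum_congr rfl fun _ _ => Finset.sum_congr rfl fun _ _ => by ring

lemma evalSharp_tensor (φ : ι → R) :
    evalSharp I (fun i j => φ i * φ j) φ = pair I φ φ ^ 2 := by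
  rw [IsMetric.pair_eq, sq, Finset.sum_mul_sum, evalSharp]
  exact Finset.sum_congr rfl fun _ _ => Finset.sum_congr rfl fun _ _ => by ring

lemma evalSharp_mul_left (c : R) (h : ι → ι → R) (φ : ι → R) :
    evalSharp I (fun i j => c * h i j) φ = c * evalSharp I h φ := by
  simp only [evalSharp, Finset.mul_sum, mul_assoc]

lemma pair_sub_right (φ ψ χ : ι → R) :
    pair I φ (fun i => ψ i - χ i) = pair I φ ψ - pair I φ χ := by
  simp only [pair, mul_sub, Finset.sum_sub_distrib]

lemma pair_mul_right (c : R) (φ ψ : ι → R) :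
    pair I φ (fun i => c * ψ i) = c * pair I φ ψ := by
  simp only [pair, Finset.mul_sum]
  exact Finset.sum_congr rfl fun _ _ => Finset.sum_congr rfl fun _ _ => by ring

lemma pair_add_right (φ ψ χ : ι → R) :
    pair I φ (fun i => ψ i + χ i) = pair I φ ψ + pair I φ χ := by
  simp only [pair, mul_add, Finset.sum_add_distrib]

lemma pair_inv_mul_left (c : R) (φ ψ : ι → R) :
    pair (fun i j => c * I i j) φ ψ = c * pair I φ ψ := by
  simp only [pair, Finset.mul_sum, mul_assoc]

variable [DecidableEq ι] [Algebra ℝ R] {D : ι → Derivation ℝ R R} {G : ι → ι → R}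

namespace IsMetric
variable (h : IsMetric D G I)
include h

lemma ip_metric_right (a : ι → ι → R) : ip I a G = tr I a := by
  unfold ip tr
  refine Finset.sum_congr rfl fun i _ => Finset.sum_congr rfl fun j _ => ?_
  rw [Finset.sum_comm]
  have : ∀ l, ∑ k, I i k * I j l * a i j * G k l = I j l * a i j * (if i = l then 1 else 0) := by
    intro l
    rw [← h.inv_mul, Finset.mul_sum]
    exact Finset.sum_congr rfl fun _ _ => by ring
  simp only [this]
  simp [h.symm_inv i j]

lemma evalSharp_metric (φ : ι → R) : evalSharp I G φ = pair I φ φ := by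
  rw [← ip_tensor_right, ip_comm h.symm_inv, h.ip_metric_right, tr_tensor]

end IsMetric

variable {Γ : ι → ι → ι → R}

omit [DecidableEq ι] in
/-- The product rule for the Laplacian. -/
lemma lap_mul (hI : ∀ i j, I i j = I j i) (a b : R) :
    tr I (hess D Γ fun j => D j (a * b)) = a * tr I (hess D Γ fun j => D j b)
      + b * tr I (hess D Γ fun j => D j a) + 2 * pair I (fun j => D j a) (fun j => D j b) := by
  have e : (hess D Γ fun j => D j (a * b)) = fun i j =>
      ((a * hess D Γ (fun j => D j b) i j + b * hess D Γ (fun j => D j a) i j)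
        + D i a * D j b) + D i b * D j a := by
    funext i j
    simp only [hess, Derivation.leibniz, smul_eq_mul, map_add, mul_add, Finset.sum_add_distrib,
      mul_sub, Finset.mul_sum]
    rw [show ∑ k, Γ k i j * (a * D k b) = ∑ k, a * (Γ k i j * D k b) from
        Finset.sum_congr rfl fun _ _ => by ring,
      show ∑ k, Γ k i j * (b * D k a) = ∑ k, b * (Γ k i j * D k a) from
        Finset.sum_congr rfl fun _ _ => by ring]
    ring
  rw [e, tr_add, tr_add, tr_add, tr_mul_left, tr_mul_left, tr_tensor (fun j => D j a),
    tr_tensor (fun j => D j b)]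
  have : pair I (fun j => D j b) (fun j => D j a) = pair I (fun j => D j a) (fun j => D j b) := by
    unfold pair
    rw [Finset.sum_comm]
    exact Finset.sum_congr rfl fun _ _ => Finset.sum_congr rfl fun _ _ => by rw [hI]; ring
  rw [this]; ring

section Einstein

variable {E E' w : R}

omit [Fintype ι] [DecidableEq ι] in
lemma deriv_inv {φ : ι → R} (hE : E * E' = 1) (hφ : ∀ i, D i E = 2 * E * φ i) (i : ι) :
    D i E' = -2 * E' * φ i := by
  have := congrArg (D i) hE
  simp only [Derivation.leibniz, smul_eq_mul, hφ, Derivation.map_one_eq_zero] at this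
  linear_combination E' * this - (D i E' + 2 * E' * φ i) * hE

variable (h : IsMetric D G I) (hι : Fintype.card ι = 4) (hE : E * E' = 1)
  (hw : ∀ i, D i E = 2 * E * D i w) (hric : ∀ i j, ric D (chr D G I) i j = -3 * G i j)
  (hlap : tr I (hess D (chr D G I) fun j => D j w) = -3)
include h hι hE hw hric hlap

/-- The Einstein term `-3g` is cancelled by `-(Δw)g = 3g`; this is what the constant in `-Δw = 3` is
for. -/
lemma ric_einstein_conformal (i j : ι) :
    ric D (chr D (fun i j => E * G i j) (fun i j => E' * I i j)) i j =
      2 * ((D i w * D j w - hess D (chr D G I) (fun j => D j w) i j)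
        - pair I (fun j => D j w) (fun j => D j w) * G i j) := by
  rw [h.ric_conformal hE hw (fun i j => h.comm i j w), hric, hlap, hι]
  push_cast; ring

/-- The scalar curvature of `e^{2w} g` for an Einstein metric `g` and a solution `w` of
`-Δw = 3`. -/
lemma scalar_einstein_conformal :
    tr (fun i j => E' * I i j)
        (ric D (chr D (fun i j => E * G i j) (fun i j => E' * I i j))) =
      6 * (E' * (1 - pair I (fun j => D j w) (fun j => D j w))) := by
  rw [tr_inv_mul_left, show ric D (chr D (fun i j => E * G i j) (fun i j => E' * I i j)) = _ from
    funext fun i => funext fun j => ric_einstein_conformal h hι hE hw hric hlap i j, tr_mul_left,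
    tr_sub, tr_sub, tr_tensor (fun j => D j w), hlap, tr_mul_left, h.tr_metric, hι]
  push_cast; ring

/-- The vanishing of the `Q`-curvature of `e^{2w} g` for an Einstein metric `g` and a solution `w`
of `-Δw = 3`. -/
lemma q_einstein_conformal :
    -tr (fun i j => E' * I i j) (hess D (chr D (fun i j => E * G i j) (fun i j => E' * I i j))
        fun k => D k (tr (fun i j => E' * I i j)
          (ric D (chr D (fun i j => E * G i j) (fun i j => E' * I i j)))))
      + (tr (fun i j => E' * I i j)
          (ric D (chr D (fun i j => E * G i j) (fun i j => E' * I i j))) ^ 2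
        - 3 * ip (fun i j => E' * I i j)
          (ric D (chr D (fun i j => E * G i j) (fun i j => E' * I i j)))
          (ric D (chr D (fun i j => E * G i j) (fun i j => E' * I i j)))) = 0 := by
  have hcl : ∀ i j, D i (D j w) = D j (D i w) := fun i j => h.comm i j w
  have c0 : ∀ i (m : ℕ), D i (m : R) = 0 := fun i m => (D i).map_natCast m
  have hE' := deriv_inv hE hw
  have s0 := scalar_einstein_conformal h hι hE hw hric hlap
  have b0 := h.bochner hcl
  have r0 := ric_einstein_conformal h hι hE hw hric hlap
  have t0 := h.tr_metric
  have pc := h.pair_comm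
  have p0 := h.pair_deriv_pair_self (fun j => D j w)
  -- `Δw` is constant, so the gradient term in Bochner's formula drops out.
  have d3 : pair I (fun a => D a (tr I (hess D (chr D G I) fun j => D j w))) (fun j => D j w)
      = 0 := by
    have : ∀ a, D a (-3 : R) = 0 := fun a => by
      rw [map_neg, show (3 : R) = ((3 : ℕ) : R) by norm_num, c0, neg_zero]
    simp [hlap, this, pair]
  have e3 : evalSharp I (ric D (chr D G I)) (fun j => D j w) =
      -3 * pair I (fun j => D j w) (fun j => D j w) := by
    rw [show ric D (chr D G I) = fun i j => -3 * G i j from funext₂ hric, evalSharp_mul_left,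
      h.evalSharp_metric]
  rw [d3, e3] at b0
  have i0 : ip (fun i j => E' * I i j)
      (ric D (chr D (fun i j => E * G i j) (fun i j => E' * I i j)))
      (ric D (chr D (fun i j => E * G i j) (fun i j => E' * I i j))) = E' ^ 2 * (4 *
        (ip I (hess D (chr D G I) fun j => D j w) (hess D (chr D G I) fun j => D j w)
          - 2 * evalSharp I (hess D (chr D G I) fun j => D j w) (fun j => D j w)
          + 3 * pair I (fun j => D j w) (fun j => D j w) ^ 2
          - 6 * pair I (fun j => D j w) (fun j => D j w))) := by
    rw [ip_inv_mul_left, show ric D (chr D (fun i j => E * G i j) (fun i j => E' * I i j)) = _ from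
      funext fun i => funext fun j => r0 i j]
    have g1 := fun a => ip_comm h.symm_inv G a
    have g2 := ip_comm h.symm_inv (hess D (chr D G I) fun j => D j w) (fun i j => D i w * D j w)
    have g3 : ip I (fun i j => D i w * D j w) (fun i j => D i w * D j w) =
        pair I (fun j => D j w) (fun j => D j w) ^ 2 := by
      rw [ip_tensor_right _ (fun j => D j w), evalSharp_tensor (fun j => D j w)]
    have g4 := ip_tensor_right (I := I) (hess D (chr D G I) fun j => D j w) (fun j => D j w)
    simp only [ip_mul_left, ip_mul_right, ip_sub_left, ip_sub_right, g1, h.ip_metric_right, t0,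
      tr_mul_left, tr_sub,
      hlap, ← g2, g3, g4, hι, tr_tensor (fun j => D j w) (fun j => D j w)]
    push_cast; ring
  rw [s0, i0]
  set f := pair I (fun j => D j w) (fun j => D j w) with hf
  set H := hess D (chr D G I) fun j => D j w with hH
  have lc : ∀ c : ℕ, tr I (hess D (chr D G I) fun k => D k (c : R)) = 0 := by
    intro c; simp only [c0]; simp [tr, hess]
  -- `Δe^{-2w} = e^{-2w}(4|dw|² - 2Δw)`, with `Δw = -3`.
  have lE : tr I (hess D (chr D G I) fun k => D k E') = E' * (6 + 4 * f) := by
    have e : (hess D (chr D G I) fun k => D k E') =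
        fun i j => -2 * E' * (hess D (chr D G I) (fun j => D j w) i j - 2 * (D i w * D j w)) := by
      funext i j
      have h2 : D i (2 : R) = 0 := by simpa using c0 i 2
      simp only [hess, hE', Derivation.leibniz, smul_eq_mul, map_neg, h2, mul_sub, Finset.mul_sum]
      rw [show ∑ k, chr D G I k i j * (-2 * E' * D k w) = ∑ k, -2 * E' * (chr D G I k i j * D k w)
        from Finset.sum_congr rfl fun _ _ => by ring]
      ring
    rw [e, tr_mul_left, tr_sub, tr_mul_left, hlap, tr_tensor (fun j => D j w)]
    ring
  have pE : ∀ ψ, pair I (fun k => D k E') ψ = -2 * E' * pair I (fun k => D k w) ψ := by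
    intro ψ
    simp only [hE']
    rw [pc, pair_mul_right, pc]
  have d1 : ∀ k, D k (6 * (E' * (1 - f))) = 6 * (-2 * E' * (1 - f) * D k w - E' * D k f) := by
    intro k
    have h6 : D k (6 : R) = 0 := by simpa using c0 k 6
    simp only [Derivation.leibniz, smul_eq_mul, h6, hE', map_sub, Derivation.map_one_eq_zero]
    ring
  have l1 : tr I (hess D (chr D G I) fun k => D k (1 - f)) =
      -tr I (hess D (chr D G I) fun k => D k f) := by
    have : (hess D (chr D G I) fun k => D k (1 - f)) =
        fun i j => -1 * hess D (chr D G I) (fun k => D k f) i j := by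
      funext i j
      simp only [hess, map_sub, Derivation.map_one_eq_zero, zero_sub, mul_neg,
        Finset.sum_neg_distrib, map_neg]
      ring
    rw [this, tr_mul_left]; ring
  have p1 : pair I (fun k => D k w) (fun k => D k (1 - f)) = -2 * evalSharp I H fun j => D j w := by
    have : (fun k => D k (1 - f)) = fun k => -1 * D k f := by
      funext k; simp
    rw [this, pair_mul_right, p0]; ring
  have p2 : pair I (fun k => D k w) (fun k => D k (6 * (E' * (1 - f)))) =
      6 * E' * (-2 * (1 - f) * f - 2 * evalSharp I H fun j => D j w) := by
    simp only [d1]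
    rw [pair_mul_right, pair_sub_right, pair_mul_right, pair_mul_right, p0, ← hf]; ring
  have c6 : pair I (fun k => D k (6 : R)) (fun k => D k (E' * (1 - f))) = 0 := by
    have h6 : ∀ k, D k (6 : R) = 0 := fun k => by simpa using c0 k 6
    simp [h6, pair]
  have l6 : tr I (hess D (chr D G I) fun k => D k (6 : R)) = 0 := by simpa using lc 6
  have l2 : tr I (hess D (chr D G I) fun k => D k (6 * (E' * (1 - f)))) =
      6 * E' * ((1 - f) * (6 + 4 * f) - tr I (hess D (chr D G I) fun k => D k f)
        + 8 * evalSharp I H fun j => D j w) := by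
    rw [lap_mul h.symm_inv, c6, l6, lap_mul h.symm_inv, pE, p1, lE, l1]
    ring
  -- With `N = |∇²w|²` and `q = ∇²w(∇w,∇w)`, in units of `E'²`: `Δ*R* = 36 - 12N + 24q`, `R*² = 36(1
  -- - f)²` and `3|Ric*|² = 12(N - 2q + 3f² - 6f)`. These cancel.
  rw [h.lap_conformal hE hw, l2, p2, b0, hι]
  push_cast
  ring

end Einstein

end Alg
end FGCompact

namespace FGCompact

/-! ### Rings of smooth functions -/

/-- `T` is a relatively open subset of `S`, and `S` is regular enough for derivatives within `S` to
be unique and symmetric. -/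
structure IsDomain {n : ℕ} (S T : Set (EuclideanSpace ℝ (Fin n))) : Prop where
  uniqueDiffOn : UniqueDiffOn ℝ S
  subset_closure : S ⊆ closure (interior S)
  subset : T ⊆ S
  mem_nhdsWithin : ∀ y ∈ T, T ∈ nhdsWithin y S

variable {n : ℕ} {S T : Set (EuclideanSpace ℝ (Fin n))}

/-- `T` is a neighbourhood within `S` of each of its points, so values on `T` determine derivatives
within `S` there. -/
lemma pd_congr (hT : IsDomain S T) {F F' : EuclideanSpace ℝ (Fin n) → ℝ} (h : EqOn F F' T)
    (i : Fin n) : EqOn (pd S i F) (pd S i F') T := by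
  intro y hy
  have : F =ᶠ[nhdsWithin y S] F' := Filter.eventuallyEq_of_mem (hT.mem_nhdsWithin y hy) h
  simp only [pd, this.fderivWithin_eq (h hy)]

lemma IsDomain.contDiffWithinAt (hT : IsDomain S T) {F : EuclideanSpace ℝ (Fin n) → ℝ}
    (hF : ContDiffOn ℝ ∞ F T) {y : EuclideanSpace ℝ (Fin n)} (hy : y ∈ T) :
    ContDiffWithinAt ℝ ∞ F S y :=
  (hF y hy).mono_of_mem_nhdsWithin (hT.mem_nhdsWithin y hy)

lemma IsDomain.differentiableWithinAt (hT : IsDomain S T) {F : EuclideanSpace ℝ (Fin n) → ℝ}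
    (hF : ContDiffOn ℝ ∞ F T) {y : EuclideanSpace ℝ (Fin n)} (hy : y ∈ T) :
    DifferentiableWithinAt ℝ F S y :=
  (hT.contDiffWithinAt hF hy).differentiableWithinAt (by simp)

lemma IsDomain.contDiffOn_pd (hT : IsDomain S T) {F : EuclideanSpace ℝ (Fin n) → ℝ}
    (hF : ContDiffOn ℝ ∞ F T) (i : Fin n) : ContDiffOn ℝ ∞ (pd S i F) T := by
  intro y hy
  have h1 : ContDiffWithinAt ℝ ∞ (fderivWithin ℝ F S) S y :=
    (hT.contDiffWithinAt hF hy).fderivWithin_right hT.uniqueDiffOn (by simp) (hT.subset hy)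
  exact (h1.clm_apply contDiffWithinAt_const).mono hT.subset

/-- Second derivatives are symmetric up to the boundary because `S` lies in the closure of its
interior. -/
lemma IsDomain.pd_comm (hT : IsDomain S T) {F : EuclideanSpace ℝ (Fin n) → ℝ}
    (hF : ContDiffOn ℝ ∞ F T) (i j : Fin n) {y : EuclideanSpace ℝ (Fin n)} (hy : y ∈ T) :
    pd S i (pd S j F) y = pd S j (pd S i F) y := by
  have h0 := hT.contDiffWithinAt hF hy
  have h1 : DifferentiableWithinAt ℝ (fderivWithin ℝ F S) S y :=
    (h0.fderivWithin_right (m := ∞) hT.uniqueDiffOn (by simp)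
      (hT.subset hy)).differentiableWithinAt (by simp)
  have h2 : ∀ i j, pd S i (pd S j F) y =
      fderivWithin ℝ (fderivWithin ℝ F S) S y (EuclideanSpace.single i 1)
        (EuclideanSpace.single j 1) := by
    intro i j
    unfold pd
    rw [fderivWithin_clm_apply (hT.uniqueDiffOn y (hT.subset hy)) h1
      (differentiableWithinAt_const _)]
    simp
  rw [h2, h2]
  exact h0.isSymmSndFDerivWithinAt (by
    simpa using (WithTop.coe_le_coe.2 (le_top : (2 : ℕ∞) ≤ ⊤) : ((2 : ℕ∞) : WithTop ℕ∞) ≤ _)) hT.uniqueDiffOn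
    (hT.subset_closure (hT.subset hy)) (hT.subset hy) _ _

variable (T) in
/-- The algebra of smooth functions on `T`. -/
def smoothFun : Subalgebra ℝ (T → ℝ) where
  carrier := {f | ∃ F : EuclideanSpace ℝ (Fin n) → ℝ, ContDiffOn ℝ ∞ F T ∧ ∀ y : T, F y = f y}
  mul_mem' := by
    rintro f g ⟨F, hF, hf⟩ ⟨F', hF', hg⟩
    exact ⟨fun y => F y * F' y, hF.mul hF', fun y => by simp [hf, hg]⟩
  add_mem' := by
    rintro f g ⟨F, hF, hf⟩ ⟨F', hF', hg⟩
    exact ⟨fun y => F y + F' y, hF.add hF', fun y => by simp [hf, hg]⟩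
  algebraMap_mem' c := ⟨fun _ => c, contDiffOn_const, fun _ => rfl⟩

variable (T) in
/-- The ring of smooth functions on `T`. -/
def SmoothRing : Type := smoothFun T

instance : CommRing (SmoothRing T) := inferInstanceAs (CommRing (smoothFun T))

instance : Algebra ℝ (SmoothRing T) := inferInstanceAs (Algebra ℝ (smoothFun T))

/-- The underlying function. -/
def SmoothRing.val (a : SmoothRing T) : T → ℝ := Subtype.val (p := (· ∈ smoothFun T)) a

/-- The function `F` represents the ring element `a`. -/
def Rep (F : EuclideanSpace ℝ (Fin n) → ℝ) (a : SmoothRing T) : Prop :=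
  ∀ y : T, F y = a.val y

/-- The ring element represented by a smooth function. -/
def toSmooth (F : EuclideanSpace ℝ (Fin n) → ℝ) (hF : ContDiffOn ℝ ∞ F T) : SmoothRing T :=
  ⟨fun y => F y, F, hF, fun _ => rfl⟩

lemma rep_toSmooth {F : EuclideanSpace ℝ (Fin n) → ℝ} (hF : ContDiffOn ℝ ∞ F T) :
    Rep F (toSmooth F hF) := fun _ => rfl

/-- A representative of a ring element. -/
def repFun (a : SmoothRing T) : EuclideanSpace ℝ (Fin n) → ℝ := a.2.choose

lemma contDiffOn_repFun (a : SmoothRing T) : ContDiffOn ℝ ∞ (repFun a) T := a.2.choose_spec.1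

lemma rep_repFun (a : SmoothRing T) : Rep (repFun a) a := a.2.choose_spec.2

/-- The evaluation at a point. -/
def evalAt (y : T) : SmoothRing T →ₐ[ℝ] ℝ := (Pi.evalAlgHom ℝ (fun _ : T => ℝ) y).comp (smoothFun T).val

lemma SmoothRing.ext_eval {a b : SmoothRing T} (h : ∀ y, evalAt y a = evalAt y b) : a = b :=
  Subtype.ext (funext h)

namespace Rep

variable {F F' : EuclideanSpace ℝ (Fin n) → ℝ} {a b : SmoothRing T}

lemma evalAt_eq (h : Rep F a) (y : T) : evalAt y a = F y := (h y).symm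

lemma eqOn (h : Rep F a) (h' : Rep F' a) : EqOn F F' T := fun y hy =>
  (h ⟨y, hy⟩).trans (h' ⟨y, hy⟩).symm

lemma apply_eq (h : Rep F a) (h' : Rep F' b) (hab : a = b) {y : EuclideanSpace ℝ (Fin n)}
    (hy : y ∈ T) : F y = F' y := (hab ▸ h).eqOn h' hy

/-- Turns an equation between functions on `T` into a ring identity; `apply_eq` goes back. -/
lemma unique (h : Rep F a) (h' : Rep F b) : a = b :=
  Subtype.ext (funext fun y => (h y).symm.trans (h' y))

lemma congr (h : Rep F a) (h' : EqOn F F' T) : Rep F' a := fun y => (h' y.2).symm.trans (h y)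

lemma contDiffOn (h : Rep F a) : ContDiffOn ℝ ∞ F T :=
  (contDiffOn_repFun a).congr (h.eqOn (rep_repFun a))

lemma add (h : Rep F a) (h' : Rep F' b) : Rep (fun y => F y + F' y) (a + b) := fun y =>
  congrArg₂ (· + ·) (h y) (h' y)

lemma sub (h : Rep F a) (h' : Rep F' b) : Rep (fun y => F y - F' y) (a - b) := fun y =>
  congrArg₂ (· - ·) (h y) (h' y)

lemma mul (h : Rep F a) (h' : Rep F' b) : Rep (fun y => F y * F' y) (a * b) := fun y =>
  congrArg₂ (· * ·) (h y) (h' y)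

lemma neg (h : Rep F a) : Rep (fun y => -F y) (-a) := fun y => congrArg (- ·) (h y)

lemma pow (h : Rep F a) (m : ℕ) : Rep (fun y => F y ^ m) (a ^ m) := fun y =>
  congrArg (· ^ m) (h y)

lemma const (c : ℝ) : Rep (T := T) (fun _ => c) (algebraMap ℝ _ c) := fun _ => rfl

lemma zero : Rep (T := T) (fun _ => 0) 0 := fun _ => rfl

lemma one : Rep (T := T) (fun _ => 1) 1 := fun _ => rfl

lemma ofNat (m : ℕ) [m.AtLeastTwo] : Rep (T := T) (fun _ => (OfNat.ofNat m : ℝ)) (OfNat.ofNat m) :=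
  fun _ => rfl

lemma sum {κ : Type*} (s : Finset κ) {F : κ → EuclideanSpace ℝ (Fin n) → ℝ} {a : κ → SmoothRing T}
    (h : ∀ k, Rep (F k) (a k)) : Rep (fun y => ∑ k ∈ s, F k y) (∑ k ∈ s, a k) := by
  intro y
  change _ = evalAt y _
  rw [map_sum]
  exact Finset.sum_congr rfl fun k _ => h k y

end Rep

/-- The partial derivatives as derivations of the ring of smooth functions. -/
def pdDeriv (hT : IsDomain S T) (i : Fin n) : Derivation ℝ (SmoothRing T) (SmoothRing T) :=
  Derivation.mk'
    -- The choice of representative is immaterial by `pd_congr`, which also lets each rule be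
    -- checked on convenient representatives.
    { toFun := fun a => toSmooth (pd S i (repFun a)) (hT.contDiffOn_pd (contDiffOn_repFun a) i)
      map_add' := fun a b => Subtype.ext <| funext fun y => by
        have := pd_congr hT ((rep_repFun (a + b)).eqOn ((rep_repFun a).add (rep_repFun b))) i y.2
        refine this.trans ?_
        simp only [pd]
        rw [fderivWithin_fun_add (hT.uniqueDiffOn y (hT.subset y.2))
          (hT.differentiableWithinAt (contDiffOn_repFun a) y.2)
          (hT.differentiableWithinAt (contDiffOn_repFun b) y.2)]
        rfl
      map_smul' := fun c a => Subtype.ext <| funext fun y => by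
        have h1 : Rep (fun y => c * (repFun a) y) (c • a) := fun y => congrArg (c * ·) ((rep_repFun a) y)
        have := pd_congr hT ((rep_repFun (c • a)).eqOn h1) i y.2
        refine this.trans ?_
        simp only [pd]
        rw [fderivWithin_const_mul (hT.uniqueDiffOn y (hT.subset y.2))
          (hT.differentiableWithinAt (contDiffOn_repFun a) y.2)]
        rfl }
    (fun a b => Subtype.ext <| funext fun y => by
      have := pd_congr hT ((rep_repFun (a * b)).eqOn ((rep_repFun a).mul (rep_repFun b))) i y.2
      refine this.trans ?_
      simp only [pd]
      rw [fderivWithin_fun_mul (hT.uniqueDiffOn y (hT.subset y.2))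
          (hT.differentiableWithinAt (contDiffOn_repFun a) y.2)
          (hT.differentiableWithinAt (contDiffOn_repFun b) y.2)]
      have ha := (rep_repFun a) y
      have hb := (rep_repFun b) y
      simp only [add_apply, smul_apply, ha, hb]
      rfl)

lemma Rep.pd (hT : IsDomain S T) {F : EuclideanSpace ℝ (Fin n) → ℝ} {a : SmoothRing T}
    (h : Rep F a) (i : Fin n) : Rep (pd S i F) (pdDeriv hT i a) := fun y =>
  pd_congr hT (h.eqOn (rep_repFun a)) i y.2

lemma pdDeriv_comm (hT : IsDomain S T) (i j : Fin n) (a : SmoothRing T) :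
    pdDeriv hT i (pdDeriv hT j a) = pdDeriv hT j (pdDeriv hT i a) :=
  Subtype.ext <| funext fun y => by
    have h1 := ((rep_repFun a).pd hT j).pd hT i y
    have h2 := ((rep_repFun a).pd hT i).pd hT j y
    exact h1.symm.trans ((hT.pd_comm (contDiffOn_repFun a) i j y.2).trans h2)

/-- The matrix `G` and its inverse are represented by `g` and `I`. -/
structure RepMetric (G : EuclideanSpace ℝ (Fin n) → Matrix (Fin n) (Fin n) ℝ)
    (g I : Fin n → Fin n → SmoothRing T) : Prop where
  metric : ∀ i j, Rep (fun y => G y i j) (g i j)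
  inv : ∀ i j, Rep (fun y => (G y)⁻¹ i j) (I i j)

/-- Cramer's rule: determinant and adjugate are formed in the ring of smooth functions, and
evaluation, a ring homomorphism, commutes with both. -/
lemma contDiffOn_matrix_inv {G : EuclideanSpace ℝ (Fin n) → Matrix (Fin n) (Fin n) ℝ}
    (hG : ∀ i j, ContDiffOn ℝ ∞ (fun y => G y i j) T) (hdet : ∀ y ∈ T, (G y).det ≠ 0)
    (i j : Fin n) : ContDiffOn ℝ ∞ (fun y => (G y)⁻¹ i j) T := by
  let g : Matrix (Fin n) (Fin n) (SmoothRing T) := Matrix.of fun i j => toSmooth _ (hG i j)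
  have hg : ∀ y : T, (evalAt y).toRingHom.mapMatrix g = G y := fun y => rfl
  have h1 : Rep (fun y => (G y).det) g.det := fun y => by
    change _ = (evalAt y).toRingHom _
    rw [RingHom.map_det, hg]
  have h2 : Rep (fun y => (G y).adjugate i j) (g.adjugate i j) := fun y => by
    change _ = (evalAt y).toRingHom.mapMatrix (g.adjugate) i j
    rw [RingHom.map_adjugate, hg]
  refine (((h1.contDiffOn).inv hdet).mul h2.contDiffOn).congr fun y _ => ?_
  simp [Matrix.inv_def]

/-- Every smooth nondegenerate symmetric matrix function defines a metric over the ring of smooth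
functions. -/
lemma exists_repMetric (hT : IsDomain S T) {G : EuclideanSpace ℝ (Fin n) → Matrix (Fin n) (Fin n) ℝ}
    (hG : ∀ i j, ContDiffOn ℝ ∞ (fun y => G y i j) T) (hdet : ∀ y ∈ T, (G y).det ≠ 0)
    (hsymm : ∀ y ∈ T, (G y).IsSymm) :
    ∃ g I, RepMetric (T := T) G g I ∧ Alg.IsMetric (pdDeriv hT) g I := by
  refine ⟨fun i j => toSmooth _ (hG i j),
    fun i j => toSmooth _ (contDiffOn_matrix_inv hG hdet i j),
    ⟨fun i j => rep_toSmooth _, fun i j => rep_toSmooth _⟩, pdDeriv_comm hT, ?_, ?_, ?_⟩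
  · exact fun i j => Subtype.ext <| funext fun y => ((hsymm y y.2).apply i j).symm
  · refine fun i j => Subtype.ext <| funext fun y => ?_
    have : ((G y)⁻¹).IsSymm := by
      rw [Matrix.IsSymm, Matrix.transpose_nonsing_inv, hsymm y y.2]
    exact (this.apply i j).symm
  · refine fun i j => SmoothRing.ext_eval fun y => ?_
    have h1 : ((G y) * (G y)⁻¹) i j = (1 : Matrix _ _ ℝ) i j := by
      rw [Matrix.mul_nonsing_inv _ (isUnit_iff_ne_zero.2 (hdet y y.2))]
    rw [Matrix.mul_apply, Matrix.one_apply] at h1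
    rw [map_sum]
    refine Eq.trans ?_ (h1.trans ?_)
    · exact Finset.sum_congr rfl fun l _ => map_mul _ _ _
    · split_ifs <;> simp

namespace RepMetric

variable {G : EuclideanSpace ℝ (Fin n) → Matrix (Fin n) (Fin n) ℝ}
  {g I : Fin n → Fin n → SmoothRing T} {F F' : EuclideanSpace ℝ (Fin n) → ℝ} {a b : SmoothRing T}

/-- Conformal metrics. -/
lemma conformal (h : RepMetric G g I) {G' : EuclideanSpace ℝ (Fin n) → Matrix (Fin n) (Fin n) ℝ}
    (ha : Rep F a) (hab : a * b = 1) (hG' : ∀ y ∈ T, G' y = F y • G y) :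
    RepMetric G' (fun i j => a * g i j) (fun i j => b * I i j) := by
  refine ⟨fun i j => (ha.mul (h.metric i j)).congr fun y hy => by simp [hG' y hy], fun i j y => ?_⟩
  have h1 : F y * evalAt y b = 1 := by rw [← ha.evalAt_eq, ← map_mul, hab, map_one]
  have hinv : (G' y)⁻¹ = evalAt y b • (G y)⁻¹ := by
    have hu : IsUnit (F y) := IsUnit.of_mul_eq_one _ h1
    rw [hG' y y.2]
    have h2 : (F y)⁻¹ = evalAt y b := inv_eq_of_mul_eq_one_right h1
    rw [← h2]
    -- A singular matrix has inverse `0` by convention, so the scaling rule needs no nondegeneracy.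
    by_cases hdet : IsUnit (G y).det
    · have := Matrix.inv_smul' (G y) (Units.mk0 (F y) hu.ne_zero) hdet
      simpa [Units.smul_def] using this
    · have hd' : ¬ IsUnit (F y • G y).det := by
        rw [Matrix.det_smul]
        exact fun hh => hdet (isUnit_of_mul_isUnit_right hh)
      rw [Matrix.nonsing_inv_apply_not_isUnit _ hd', Matrix.nonsing_inv_apply_not_isUnit _ hdet]
      simp
  simp only [hinv, Matrix.smul_apply, smul_eq_mul]
  exact congrArg (evalAt y b * ·) (h.inv i j y)

variable (hT : IsDomain S T) (h : RepMetric G g I)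
include h

lemma christoffel (k i j : Fin n) :
    Rep (christoffel S G k i j) (Alg.chr (pdDeriv hT) g I k i j) :=
  (Rep.const _).mul (Rep.sum _ fun l => (h.inv k l).mul
    ((((h.metric j l).pd hT i).add ((h.metric i l).pd hT j)).sub ((h.metric i j).pd hT l)))

lemma riemannUp (l k i j : Fin n) :
    Rep (riemannUp S G l k i j) (Alg.curv (pdDeriv hT) (Alg.chr (pdDeriv hT) g I) l k i j) :=
  (((h.christoffel hT l j k).pd hT i).sub ((h.christoffel hT l i k).pd hT j)).add
    (Rep.sum _ fun m => ((h.christoffel hT l i m).mul (h.christoffel hT m j k)).sub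
      ((h.christoffel hT l j m).mul (h.christoffel hT m i k)))

lemma ricci (j k : Fin n) :
    Rep (ricci S G j k) (Alg.ric (pdDeriv hT) (Alg.chr (pdDeriv hT) g I) j k) :=
  Rep.sum _ fun i => h.riemannUp hT i k i j

lemma scalarCurv :
    Rep (scalarCurv S G) (Alg.tr I (Alg.ric (pdDeriv hT) (Alg.chr (pdDeriv hT) g I))) :=
  Rep.sum _ fun i => Rep.sum _ fun j => (h.inv i j).mul (h.ricci hT i j)

lemma ricciNormSq :
    Rep (ricciNormSq S G) (Alg.ip I (Alg.ric (pdDeriv hT) (Alg.chr (pdDeriv hT) g I))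
      (Alg.ric (pdDeriv hT) (Alg.chr (pdDeriv hT) g I))) :=
  Rep.sum _ fun i => Rep.sum _ fun j => Rep.sum _ fun k => Rep.sum _ fun l =>
    (((h.inv i k).mul (h.inv j l)).mul (h.ricci hT i j)).mul (h.ricci hT k l)

lemma gradPair (ha : Rep F a) (hb : Rep F' b) :
    Rep (gradPair S G F F') (Alg.pair I (fun i => pdDeriv hT i a) (fun i => pdDeriv hT i b)) :=
  Rep.sum _ fun i => Rep.sum _ fun j => ((h.inv i j).mul (ha.pd hT i)).mul (hb.pd hT j)

lemma hessian (ha : Rep F a) (i j : Fin n) :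
    Rep (fun y => FGCompact.pd S i (FGCompact.pd S j F) y
        - ∑ k, FGCompact.christoffel S G k i j y * FGCompact.pd S k F y)
      (Alg.hess (pdDeriv hT) (Alg.chr (pdDeriv hT) g I) (fun i => pdDeriv hT i a) i j) :=
  ((ha.pd hT j).pd hT i).sub (Rep.sum _ fun k => (h.christoffel hT k i j).mul (ha.pd hT k))

lemma laplacian (ha : Rep F a) :
    Rep (laplacian S G F) (Alg.tr I
      (Alg.hess (pdDeriv hT) (Alg.chr (pdDeriv hT) g I) fun i => pdDeriv hT i a)) :=
  Rep.sum _ fun i => Rep.sum _ fun j => (h.inv i j).mul (h.hessian hT ha i j)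

end RepMetric

end FGCompact

/-! ### Algebra of the compactification: Einstein equation and scalar curvature -/

namespace FGCompact

namespace Alg

variable {ι : Type*} [Fintype ι] [DecidableEq ι] {R : Type*} [CommRing R] [Algebra ℝ R]
  {D : ι → Derivation ℝ R R} {G I : ι → ι → R}

lemma deriv_of_mul_eq_one {r ρ : R} (δ : Derivation ℝ R R) (hr : r * ρ = 1) :
    δ ρ = -(ρ ^ 2 * δ r) := by
  have := congrArg δ hr
  simp only [Derivation.leibniz, smul_eq_mul, Derivation.map_one_eq_zero] at this
  linear_combination ρ * this - δ ρ * hr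

/-- The Einstein equation for `r⁻² g` in terms of `g`, when `|dr|² = 1`. -/
lemma einstein_compactification (h : IsMetric D G I) (hι : Fintype.card ι = 4) {r ρ : R}
    (hr : r * ρ = 1) (hpair : pair I (fun i => D i r) (fun i => D i r) = 1) {i j : ι}
    (hric : ric D (chr D (fun i j => ρ ^ 2 * G i j) (fun i j => r ^ 2 * I i j)) i j =
      -3 * (ρ ^ 2 * G i j)) :
    r * ric D (chr D G I) i j + 2 * hess D (chr D G I) (fun k => D k r) i j
      + tr I (hess D (chr D G I) fun k => D k r) * G i j = 0 := by
  have hE : ρ ^ 2 * r ^ 2 = 1 := by rw [← mul_pow, mul_comm, hr, one_pow]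
  have hρ := fun k => deriv_of_mul_eq_one (D k) hr
  -- The factor is `r⁻² = e^{2f}` with `f = -log r`, so `df = -ρ dr`.
  have hφ : ∀ k, D k (ρ ^ 2) = 2 * ρ ^ 2 * (-(ρ * D k r)) := by
    intro k
    rw [Derivation.leibniz_pow, hρ]
    simp only [smul_eq_mul, nsmul_eq_mul]
    push_cast; ring
  have hcl : ∀ k l, D k (-(ρ * D l r)) = D l (-(ρ * D k r)) := by
    intro k l
    simp only [map_neg, Derivation.leibniz, smul_eq_mul, hρ, h.comm k l r]
    ring
  have hhess : hess D (chr D G I) (fun k => -(ρ * D k r)) = fun k l =>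
      ρ ^ 2 * (D k r * D l r) - ρ * hess D (chr D G I) (fun k => D k r) k l := by
    funext k l
    simp only [hess, map_neg, Derivation.leibniz, smul_eq_mul, hρ, mul_neg, Finset.sum_neg_distrib,
      mul_sub, Finset.mul_sum]
    rw [show ∑ m, chr D G I m k l * (ρ * D m r) = ∑ m, ρ * (chr D G I m k l * D m r) from
        Finset.sum_congr rfl fun _ _ => by ring]
    ring
  have hp : pair I (fun k => -(ρ * D k r)) (fun k => -(ρ * D k r)) = ρ ^ 2 := by
    rw [show (fun k => -(ρ * D k r)) = fun k => -ρ * D k r from by funext k; ring, pair_mul_right,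
      h.pair_comm, pair_mul_right, hpair]
    ring
  -- The `dr⊗dr` terms cancel. Since `|dr|² = 1`, the coefficient of `G` is `-(3ρ² - ρΔr)`, whose
  -- singular part matches the Einstein term `-3ρ²G`; multiplying by `r` gives a regular equation.
  have key := h.ric_conformal hE hφ hcl i j
  rw [hric, hp, hhess, tr_sub, tr_mul_left, tr_mul_left, tr_tensor (fun k => D k r), hpair, hι]
    at key
  push_cast at key
  have hr' : r ^ 2 * ρ ^ 2 = 1 := by rw [← mul_pow, hr, one_pow]
  linear_combination -r * key - (2 * hess D (chr D G I) (fun k => D k r) i j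
    + tr I (hess D (chr D G I) fun k => D k r) * G i j) * hr

/-- The scalar curvature of `e^{2w} g⁺` in terms of the compactification `g = r² g⁺`. -/
lemma scalar_compactification (h : IsMetric D G I) (hι : Fintype.card ι = 4) {r ρ w u E E' e e' : R}
    (hr : r * ρ = 1) (hpair : pair I (fun i => D i r) (fun i => D i r) = 1)
    (hric : ∀ i j, ric D (chr D (fun i j => ρ ^ 2 * G i j) (fun i j => r ^ 2 * I i j)) i j =
      -3 * (ρ ^ 2 * G i j))
    (hlap : tr (fun i j => r ^ 2 * I i j) (hess D (chr D (fun i j => ρ ^ 2 * G i j)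
      (fun i j => r ^ 2 * I i j)) fun i => D i w) = -3)
    (hE : E * E' = 1) (hw : ∀ i, D i E = 2 * E * D i w)
    (he : e * e' = 1) (hu : ∀ i, D i e = 2 * e * D i u) (hEe : E = r ^ 2 * e) :
    r * tr (fun i j => E' * (r ^ 2 * I i j)) (ric D (chr D (fun i j => E * (ρ ^ 2 * G i j))
      (fun i j => E' * (r ^ 2 * I i j)))) =
    -6 * (e' * (2 * pair I (fun i => D i r) (fun i => D i u)
      + r * pair I (fun i => D i u) (fun i => D i u))) := by
  have hE1 : ρ ^ 2 * r ^ 2 = 1 := by rw [← mul_pow, mul_comm, hr, one_pow]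
  have hE' : E' = ρ ^ 2 * e' := by
    have : E * (ρ ^ 2 * e') = 1 := by rw [hEe]; linear_combination he + e * e' * hE1
    calc E' = E' * (E * (ρ ^ 2 * e')) := by rw [this, mul_one]
      _ = ρ ^ 2 * e' := by linear_combination (ρ ^ 2 * e') * hE
  -- This is the derivative of `w = log r + u`, extracted from `E = r² e` because no logarithm is
  -- available in the ring.
  have hdw : ∀ i, D i w = ρ * D i r + D i u := by
    intro i
    have h1 := hw i
    rw [hEe, Derivation.leibniz, Derivation.leibniz_pow, hu] at h1
    simp only [smul_eq_mul, nsmul_eq_mul] at h1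
    push_cast at h1
    have h2 : 2 * (D i w - (ρ * D i r + D i u)) = 0 := by
      linear_combination -(ρ ^ 2 * e') * h1 - (2 * (D i w - (ρ * D i r + D i u))) * he
        - 2 * (e * e') * (D i w - D i u) * hE1 + 2 * (e * e') * ρ * D i r * hr
    have h3 := congrArg (algebraMap ℝ R (1 / 2) * ·) h2
    simp only [two_mul, mul_add, half_add_half, mul_zero] at h3
    exact sub_eq_zero.1 h3
  rw [scalar_einstein_conformal (h.conformal hE1) hι hE hw hric hlap, pair_inv_mul_left]
  -- The leading term `ρ²` comes from `|dr|² = 1`; times `r²` it cancels the `1` in `1 - |dw|²`,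
  -- leaving an expression regular at `r = 0`.
  have hf : pair I (fun i => D i w) (fun i => D i w) = ρ ^ 2
      + 2 * ρ * pair I (fun i => D i r) (fun i => D i u)
      + pair I (fun i => D i u) (fun i => D i u) := by
    simp only [hdw]
    rw [pair_add_right, pair_mul_right, h.pair_comm _ (fun i => D i r), pair_add_right,
      pair_mul_right, hpair, h.pair_comm (fun i => ρ * D i r + D i u) (fun i => D i u),
      pair_add_right, pair_mul_right, h.pair_comm (fun i => D i u) (fun i => D i r)]
    ring
  rw [hf, hE']
  linear_combination -(12 * e' * pair I (fun i => D i r) (fun i => D i u)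
      * (1 + r * ρ + (r * ρ) ^ 2) + 6 * r * e' * pair I (fun i => D i u) (fun i => D i u)
      * (1 + r * ρ) + 6 * ρ * e' * (r * ρ) * (1 + r * ρ)) * hr

/-- The derivation along the gradient of `r`. -/
def gradDeriv (D : ι → Derivation ℝ R R) (I : ι → ι → R) (r : R) : Derivation ℝ R R :=
  ∑ j, sharp I (fun i => D i r) j • D j

lemma gradDeriv_eq (h : IsMetric D G I) (r a : R) :
    gradDeriv D I r a = pair I (fun i => D i r) (fun i => D i a) := by
  rw [h.pair_comm, IsMetric.pair_eq, gradDeriv]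
  have := congrFun (map_sum (Derivation.coeFnAddMonoidHom (R := ℝ) (A := R) (M := R))
    (fun j => sharp I (fun i => D i r) j • D j) Finset.univ) a
  refine this.trans ?_
  rw [Finset.sum_apply]
  exact Finset.sum_congr rfl fun j _ => by simp [mul_comm]

/-- The normal derivative of the scalar curvature at a boundary point. -/
lemma gradDeriv_scalar (h : IsMetric D G I) {r u e e' s a b : R} (ev : R →ₐ[ℝ] ℝ)
    (hpair : pair I (fun i => D i r) (fun i => D i r) = 1)
    (he : e * e' = 1) (hu : ∀ i, D i e = 2 * e * D i u)
    (hs : r * s = -6 * (e' * (2 * gradDeriv D I r u + r * pair I (fun i => D i u) (fun i => D i u))))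
    (hab : u = a + b * r ^ 3) (ev_r : ev r = 0) (ev_e : ev e' = 1) (ev_u : ∀ i, ev (D i u) = 0)
    (ev_a : ev (gradDeriv D I r (gradDeriv D I r (gradDeriv D I r a))) = 0) :
    ev (gradDeriv D I r s) = -36 * ev b := by
  set δ := gradDeriv D I r with hδ
  have hr : δ r = 1 := by rw [gradDeriv_eq h, hpair]
  set q := pair I (fun i => D i u) (fun i => D i u) with hq
  have ev_sharp : ∀ i, ev (sharp I (fun i => D i u) i) = 0 := by
    intro i; simp [sharp, ev_u]
  have ev_q : ev q = 0 := by rw [hq, IsMetric.pair_eq]; simp [ev_u]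
  have ev_du : ev (δ u) = 0 := by rw [gradDeriv_eq h, IsMetric.pair_eq]; simp [ev_sharp]
  -- `|du|²` vanishes to second order where `du = 0`.
  have ev_dq : ev (δ q) = 0 := by
    rw [gradDeriv_eq h, h.pair_comm, IsMetric.pair_eq]
    simp [hq, h.deriv_pair_self, ev_sharp]
  have hde : δ e' = -2 * e' * δ u := by
    have := fun i => deriv_inv he hu i
    rw [gradDeriv_eq h, gradDeriv_eq h]
    simp only [this, pair_mul_right]
  -- At `r = 0` only `b δ³(r³) = 6b` survives, the third derivative of `a` being zero by assumption.
  have h3 : ev (δ (δ (δ u))) = 6 * ev b := by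
    rw [hab]
    simp only [map_add, Derivation.leibniz, Derivation.leibniz_pow, smul_eq_mul, nsmul_eq_mul, hr,
      map_mul, map_pow, ev_a, ev_r, Derivation.map_natCast, Derivation.map_one_eq_zero]
    simp [map_ofNat]; ring
  -- As `δ r = 1`, the left side yields `2δs` at `r = 0`. On the right every term but `-12 δ³u`
  -- carries a factor `r`, `δu`, `q` or `δq`, all zero there.
  have key := congrArg (fun x => ev (δ (δ x))) hs
  have h6 : δ (-6 : R) = 0 := by
    rw [map_neg, show (6 : R) = ((6 : ℕ) : R) by norm_num, Derivation.map_natCast, neg_zero]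
  have h2 : δ (2 : R) = 0 := by simpa using δ.map_natCast 2
  simp only [Derivation.leibniz, smul_eq_mul, hr, h6, h2, hde, map_add, map_mul, map_neg, ev_r, ev_q,
    ev_du, ev_dq, ev_e, h3, Derivation.map_one_eq_zero] at key
  simp [map_ofNat] at key
  linarith

end Alg

end FGCompact

/-! ### Transfer of the algebraic identities to local coordinates -/

namespace FGCompact

section Exp

variable {n : ℕ} {S T : Set (EuclideanSpace ℝ (Fin n))}

/-- The exponential `e^{2u}` in the ring of smooth functions. -/
lemma exists_exp (hT : IsDomain S T) {F : EuclideanSpace ℝ (Fin n) → ℝ} {u : SmoothRing T}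
    (hu : Rep F u) : ∃ e e' : SmoothRing T, Rep (fun y => Real.exp (2 * F y)) e ∧
      Rep (fun y => Real.exp (-(2 * F y))) e' ∧ e * e' = 1 ∧
      ∀ i, pdDeriv hT i e = 2 * e * pdDeriv hT i u := by
  have hF := hu.contDiffOn
  have h2 : ContDiffOn ℝ ∞ (fun y => 2 * F y) T := contDiffOn_const.mul hF
  have r1 := rep_toSmooth h2.exp
  have r2 := rep_toSmooth h2.neg.exp
  refine ⟨_, _, r1, r2, ?_, fun i => ?_⟩
  · refine Rep.unique (r1.mul r2) (Rep.one.congr fun y _ => ?_)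
    change 1 = _ * _
    rw [← Real.exp_add]; simp
  · refine Rep.unique (r1.pd hT i)
      ((((Rep.ofNat 2).mul r1).mul (hu.pd hT i)).congr fun y hy => ?_)
    have hd := hT.differentiableWithinAt hF hy
    have hu := hT.uniqueDiffOn y (hT.subset hy)
    simp only [pd]
    rw [fderivWithin_exp (hd.const_mul 2) hu, fderivWithin_const_mul hu hd]
    simp; ring

end Exp

variable {S T T' : Set (EuclideanSpace ℝ (Fin 4))}

/-- The hypotheses on a metric in local coordinates. -/
structure IsSmoothMetricOn (T : Set (EuclideanSpace ℝ (Fin 4)))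
    (G : EuclideanSpace ℝ (Fin 4) → Matrix (Fin 4) (Fin 4) ℝ) : Prop where
  smooth : ∀ i j, ContDiffOn ℝ ∞ (fun y => G y i j) T
  det_ne_zero : ∀ y ∈ T, (G y).det ≠ 0
  symm : ∀ y ∈ T, (G y).IsSymm

lemma IsSmoothMetricOn.mono {G : EuclideanSpace ℝ (Fin 4) → Matrix (Fin 4) (Fin 4) ℝ}
    (h : IsSmoothMetricOn T G) (hT : T' ⊆ T) : IsSmoothMetricOn T' G :=
  ⟨fun i j => (h.smooth i j).mono hT, fun y hy => h.det_ne_zero y (hT hy),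
    fun y hy => h.symm y (hT hy)⟩

/-- Needed to extend the vanishing of `Q` from the interior to the boundary by continuity. -/
lemma contDiffOn_qCurv (hT : IsDomain halfSpace T)
    {G : EuclideanSpace ℝ (Fin 4) → Matrix (Fin 4) (Fin 4) ℝ} (hG : IsSmoothMetricOn T G) :
    ContDiffOn ℝ ∞ (qCurv G) T := by
  obtain ⟨g, I, hr, h⟩ := exists_repMetric hT hG.smooth hG.det_ne_zero hG.symm
  have hs := hr.scalarCurv hT
  exact ((Rep.const (1 / 2)).mul (((Rep.const (-(1 / 6))).mul (hr.laplacian hT hs)).add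
    ((Rep.const (1 / 6)).mul ((hs.pow 2).sub ((Rep.const 3).mul (hr.ricciNormSq hT)))))).contDiffOn

/-- The vanishing of the `Q`-curvature of `e^{2w} g⁺`. -/
lemma qCurv_eq_zero (hT : IsDomain halfSpace T)
    {Gp Gs : EuclideanSpace ℝ (Fin 4) → Matrix (Fin 4) (Fin 4) ℝ} (hG : IsSmoothMetricOn T Gp)
    {w : EuclideanSpace ℝ (Fin 4) → ℝ} (hw : ContDiffOn ℝ ∞ w T)
    (hric : ∀ y ∈ T, ∀ i j, ricci halfSpace Gp i j y = -3 * Gp y i j)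
    (hlap : ∀ y ∈ T, -laplacian halfSpace Gp w y = 3)
    (hs : ∀ y ∈ T, Gs y = Real.exp (2 * w y) • Gp y) {y : EuclideanSpace ℝ (Fin 4)} (hy : y ∈ T) :
    qCurv Gs y = 0 := by
  obtain ⟨g, I, hr, h⟩ := exists_repMetric hT hG.smooth hG.det_ne_zero hG.symm
  have rw0 := rep_toSmooth hw
  obtain ⟨E, E', rE, -, hE, hEw⟩ := exists_exp hT rw0
  have hr' := hr.conformal rE hE hs
  have sc := hr'.scalarCurv hT
  have q := Alg.q_einstein_conformal h (by simp) hE hEw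
    (fun i j => Rep.unique (hr.ricci hT i j) (((Rep.ofNat 3).neg.mul (hr.metric i j)).congr
      fun y hy => (hric y hy i j).symm))
    (Rep.unique (hr.laplacian hT rw0) ((Rep.ofNat 3).neg.congr fun y hy => by
      have := hlap y hy; change -3 = laplacian _ _ _ _; linarith))
  have key := (((hr'.laplacian hT sc).neg).add
    ((sc.pow 2).sub ((Rep.ofNat 3).mul (hr'.ricciNormSq hT)))).apply_eq Rep.zero q hy
  unfold qCurv
  linarith

section Boundary

variable {Gb Gp Gs : EuclideanSpace ℝ (Fin 4) → Matrix (Fin 4) (Fin 4) ℝ}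
  {r w u : EuclideanSpace ℝ (Fin 4) → ℝ}

/-- A compactified Einstein metric in local coordinates on `T`, with interior `T'`. -/
structure IsLocalCompactification (S T T' : Set (EuclideanSpace ℝ (Fin 4)))
    (Gb Gp : EuclideanSpace ℝ (Fin 4) → Matrix (Fin 4) (Fin 4) ℝ)
    (r : EuclideanSpace ℝ (Fin 4) → ℝ) : Prop where
  domain : IsDomain S T
  domain' : IsDomain S T'
  subset : T' ⊆ T
  subset_closure : T ⊆ closure T'
  metric : IsSmoothMetricOn T Gb
  smooth : ContDiffOn ℝ ∞ r T
  pos : ∀ y ∈ T', 0 < r y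
  norm_diff : ∀ y ∈ T, gradPair S Gb r r y = 1
  compact : ∀ y ∈ T', Gb y = r y ^ 2 • Gp y
  einstein : ∀ y ∈ T', ∀ i j, ricci S Gp i j y = -3 * Gp y i j

namespace IsLocalCompactification

variable (h : IsLocalCompactification S T T' Gb Gp r)
include h

/-- On `T'` the function `r` is invertible, so `g⁺ = ρ² gbar` can be expressed in its ring of smooth
functions; over `T` it cannot. -/
lemma exists_rep : ∃ (g I : Fin 4 → Fin 4 → SmoothRing T') (rr ρ : SmoothRing T'),
    RepMetric Gb g I ∧ Alg.IsMetric (pdDeriv h.domain') g I ∧ Rep r rr ∧ rr * ρ = 1 ∧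
    Rep (fun y => (r y)⁻¹) ρ ∧
    Alg.pair I (fun i => pdDeriv h.domain' i rr) (fun i => pdDeriv h.domain' i rr) = 1 ∧
    RepMetric Gp (fun i j => ρ ^ 2 * g i j) (fun i j => rr ^ 2 * I i j) ∧
    ∀ i j, Alg.ric (pdDeriv h.domain') (Alg.chr (pdDeriv h.domain') (fun i j => ρ ^ 2 * g i j)
      (fun i j => rr ^ 2 * I i j)) i j = -3 * (ρ ^ 2 * g i j) := by
  have hG := h.metric.mono h.subset
  obtain ⟨g, I, hr, hm⟩ := exists_repMetric h.domain' hG.smooth hG.det_ne_zero hG.symm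
  have hr0 : ContDiffOn ℝ ∞ r T' := h.smooth.mono h.subset
  have r1 := rep_toSmooth hr0
  have r2 := rep_toSmooth (hr0.inv fun y hy => (h.pos y hy).ne')
  have hrρ : toSmooth r hr0 * toSmooth _ (hr0.inv fun y hy => (h.pos y hy).ne') = 1 :=
    Rep.unique (r1.mul r2) (Rep.one.congr fun y hy =>
      (mul_inv_cancel₀ (h.pos y hy).ne').symm)
  have hp : RepMetric Gp _ _ := hr.conformal (r2.pow 2) (b := toSmooth r hr0 ^ 2)
    (by rw [← mul_pow, mul_comm, hrρ, one_pow]) (G' := Gp) (fun y hy => by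
      rw [h.compact y hy, smul_smul, Pi.inv_apply, inv_pow,
        inv_mul_cancel₀ (pow_ne_zero 2 (h.pos y hy).ne'), one_smul])
  refine ⟨g, I, toSmooth r hr0, _, hr, hm, r1, hrρ, r2, ?_, hp, fun i j => ?_⟩
  · exact Rep.unique (hr.gradPair h.domain' r1 r1) (Rep.one.congr fun y hy =>
      (h.norm_diff y (h.subset hy)).symm)
  · exact Rep.unique (hp.ricci h.domain' i j) (((Rep.ofNat 3).neg.mul (hp.metric i j)).congr
      fun y hy => (h.einstein y hy i j).symm)

/-- Identities obtained by dividing by `r` on `T'` pass to `T` by continuity and density. -/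
lemma eqOn {F F' : EuclideanSpace ℝ (Fin 4) → ℝ} (hF : ContDiffOn ℝ ∞ F T)
    (hF' : ContDiffOn ℝ ∞ F' T) (he : EqOn F F' T') : EqOn F F' T :=
  he.of_subset_closure hF.continuousOn hF'.continuousOn h.subset h.subset_closure

/-- The Einstein equation up to the boundary. -/
lemma einstein_eq {y : EuclideanSpace ℝ (Fin 4)} (hy : y ∈ T) (i j : Fin 4) :
    r y * ricci S Gb i j y + 2 * (pd S i (pd S j r) y - ∑ k, christoffel S Gb k i j y * pd S k r y)
      + laplacian S Gb r y * Gb y i j = 0 := by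
  -- The expression is represented over two rings: over `T` for its smoothness, over `T'` for the
  -- identity.
  have rep : ∀ {T₀} (hT₀ : IsDomain S T₀) {g I : Fin 4 → Fin 4 → SmoothRing T₀} {rr : SmoothRing T₀},
      RepMetric Gb g I → Rep r rr → Rep (fun y => r y * ricci S Gb i j y
        + 2 * (pd S i (pd S j r) y - ∑ k, christoffel S Gb k i j y * pd S k r y)
        + laplacian S Gb r y * Gb y i j) _ := fun hT₀ _ _ _ hr hrr =>
    ((hrr.mul (hr.ricci hT₀ i j)).add ((Rep.ofNat 2).mul (hr.hessian hT₀ hrr i j))).add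
      ((hr.laplacian hT₀ hrr).mul (hr.metric i j))
  obtain ⟨g, I, hr, hm⟩ := exists_repMetric h.domain h.metric.smooth h.metric.det_ne_zero
    h.metric.symm
  refine h.eqOn (rep h.domain hr (rep_toSmooth h.smooth)).contDiffOn
    (contDiffOn_const (c := 0)) (fun z hz => ?_) hy
  obtain ⟨g', I', rr, ρ, hg', hm', hrr, hrρ, -, hpair, -, hric⟩ := h.exists_rep
  have key := Alg.einstein_compactification hm' (by simp) hrρ hpair (hric i j)
  exact (rep h.domain' hg' hrr).apply_eq Rep.zero key hz

/-- The scalar curvature of `e^{2w} g⁺` near the boundary. -/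
lemma scalarCurv_eq (hw : ContDiffOn ℝ ∞ w T') (hu : ContDiffOn ℝ ∞ u T)
    (hwu : ∀ y ∈ T', w y = Real.log (r y) + u y)
    (hlap : ∀ y ∈ T', -laplacian S Gp w y = 3)
    (hs : ∀ y ∈ T, Gs y = Real.exp (2 * u y) • Gb y) {y : EuclideanSpace ℝ (Fin 4)} (hy : y ∈ T) :
    r y * scalarCurv S Gs y = -6 * (Real.exp (-(2 * u y)) *
      (2 * gradPair S Gb r u y + r y * gradPair S Gb u u y)) := by
  obtain ⟨g, I, hr, hm⟩ := exists_repMetric h.domain h.metric.smooth h.metric.det_ne_zero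
    h.metric.symm
  have ru := rep_toSmooth hu
  have rr := rep_toSmooth h.smooth
  obtain ⟨e, e', re, re', hee, -⟩ := exists_exp h.domain ru
  refine h.eqOn (rr.mul ((hr.conformal re hee hs).scalarCurv h.domain)).contDiffOn
    ((Rep.ofNat 6).neg.mul (re'.mul (((Rep.ofNat 2).mul (hr.gradPair h.domain rr ru)).add
      (rr.mul (hr.gradPair h.domain ru ru))))).contDiffOn (fun z hz => ?_) hy
  clear! e e' g I
  clear rr ru
  obtain ⟨g, I, rr, ρ, hg, hm, hrr, hrρ, -, hpair, hgp, hric⟩ := h.exists_rep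
  have ru := rep_toSmooth (hu.mono h.subset)
  have rw0 := rep_toSmooth hw
  obtain ⟨e, e', re, re', hee, heu⟩ := exists_exp h.domain' ru
  obtain ⟨E, E', rE, rE', hE, hEw⟩ := exists_exp h.domain' rw0
  have hexp : ∀ y ∈ T', Real.exp (2 * w y) = r y ^ 2 * Real.exp (2 * u y) := by
    intro y hy
    rw [hwu y hy, mul_add, Real.exp_add, two_mul (Real.log _), Real.exp_add,
      Real.exp_log (h.pos y hy), sq]
  have key := Alg.scalar_compactification hm (by simp) hrρ hpair hric
    (Rep.unique (hgp.laplacian h.domain' rw0) ((Rep.ofNat 3).neg.congr fun y hy => by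
      have := hlap y hy; change -3 = laplacian _ _ _ _; linarith)) hE hEw hee heu
    (Rep.unique rE (((hrr.pow 2).mul re).congr fun y hy => (hexp y hy).symm))
  have hgs : RepMetric Gs _ _ := hgp.conformal (G' := Gs) rE hE fun y hy => by
    rw [hs y (h.subset hy), h.compact y hy, hexp y hy, smul_smul, mul_comm]
  exact (hrr.mul (hgs.scalarCurv h.domain')).apply_eq ((Rep.ofNat 6).neg.mul
    (re'.mul (((Rep.ofNat 2).mul (hg.gradPair h.domain' hrr ru)).add
      (hrr.mul (hg.gradPair h.domain' ru ru))))) key hz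

/-- The derivative of the scalar curvature of `e^{2w} g⁺` along the gradient of `r` at the
boundary. -/
lemma gradPair_scalarCurv (hw : ContDiffOn ℝ ∞ w T') (hu : ContDiffOn ℝ ∞ u T)
    (hwu : ∀ y ∈ T', w y = Real.log (r y) + u y)
    (hlap : ∀ y ∈ T', -laplacian S Gp w y = 3)
    (hs : ∀ y ∈ T, Gs y = Real.exp (2 * u y) • Gb y) {A B : EuclideanSpace ℝ (Fin 4) → ℝ}
    (hA : ContDiffOn ℝ ∞ A T) (hB : ContDiffOn ℝ ∞ B T)
    (hAB : ∀ y ∈ T, u y = A y + B y * r y ^ 3) {y : EuclideanSpace ℝ (Fin 4)} (hy : y ∈ T)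
    (hr0 : r y = 0) (hu0 : u y = 0) (hdu : ∀ i, pd S i u y = 0)
    (hA3 : gradPair S Gb r (gradPair S Gb r (gradPair S Gb r A)) y = 0) :
    gradPair S Gb r (scalarCurv S Gs) y = -36 * B y := by
  obtain ⟨g, I, hr, hm⟩ := exists_repMetric h.domain h.metric.smooth h.metric.det_ne_zero
    h.metric.symm
  have ru := rep_toSmooth hu
  have rr := rep_toSmooth h.smooth
  have rA := rep_toSmooth hA
  have rB := rep_toSmooth hB
  obtain ⟨e, e', re, re', hee, heu⟩ := exists_exp h.domain ru
  have rs := (hr.conformal re hee hs).scalarCurv h.domain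
  have rδ : ∀ {F : EuclideanSpace ℝ (Fin 4) → ℝ} {a}, Rep F a → Rep (gradPair S Gb r F)
      (Alg.gradDeriv (pdDeriv h.domain) I (toSmooth r h.smooth) a) := fun ha => by
    rw [Alg.gradDeriv_eq hm]; exact hr.gradPair h.domain rr ha
  have key := Alg.gradDeriv_scalar hm (evalAt ⟨y, hy⟩)
    (Rep.unique (hr.gradPair h.domain rr rr) (Rep.one.congr fun y hy =>
      (h.norm_diff y hy).symm)) hee heu
    (Rep.unique (rr.mul rs) (((Rep.ofNat 6).neg.mul (re'.mul (((Rep.ofNat 2).mul (rδ ru)).add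
      (rr.mul (hr.gradPair h.domain ru ru))))).congr fun y hy =>
        (h.scalarCurv_eq hw hu hwu hlap hs hy).symm))
    (Rep.unique ru ((rA.add (rB.mul (rr.pow 3))).congr fun y hy => (hAB y hy).symm))
    (by rw [rr.evalAt_eq, hr0]) (by rw [re'.evalAt_eq, hu0]; simp)
    (fun i => by rw [(ru.pd h.domain i).evalAt_eq, hdu])
    (by rw [(rδ (rδ (rδ rA))).evalAt_eq, hA3])
  rwa [(rδ rs).evalAt_eq, rB.evalAt_eq] at key

end IsLocalCompactification

end Boundary

end FGCompact

namespace FGCompact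

/-! ### Charts -/

section Chart

open Topology

variable {X : Type*} [TopologicalSpace X] [ChartedSpace (EuclideanHalfSpace 4) X]
  [IsManifold (𝓡∂ 4) ∞ X] {e : OpenPartialHomeomorph X (EuclideanHalfSpace 4)}

/-- The part of the target of a chart which corresponds to `V`. -/
def chartDomain (e : OpenPartialHomeomorph X (EuclideanHalfSpace 4)) (V : Set X) :
    Set (EuclideanSpace ℝ (Fin 4)) :=
  (e.extend (𝓡∂ 4)).target ∩ (e.extend (𝓡∂ 4)).symm ⁻¹' V

omit [ChartedSpace (EuclideanHalfSpace 4) X] [IsManifold (𝓡∂ 4) ∞ X] in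
lemma symm_mem_source {y : EuclideanSpace ℝ (Fin 4)} (hy : y ∈ (e.extend (𝓡∂ 4)).target) :
    (e.extend (𝓡∂ 4)).symm y ∈ e.source := by
  simpa using (e.extend (𝓡∂ 4)).map_target hy

omit [ChartedSpace (EuclideanHalfSpace 4) X] [IsManifold (𝓡∂ 4) ∞ X] in
lemma target_mem_nhdsWithin {y : EuclideanSpace ℝ (Fin 4)}
    (hy : y ∈ (e.extend (𝓡∂ 4)).target) : (e.extend (𝓡∂ 4)).target ∈ 𝓝[halfSpace] y := by
  have := e.extend_target_mem_nhdsWithin (I := 𝓡∂ 4) (symm_mem_source hy)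
  rwa [(e.extend (𝓡∂ 4)).right_inv hy] at this

omit [ChartedSpace (EuclideanHalfSpace 4) X] [IsManifold (𝓡∂ 4) ∞ X] in
lemma isDomain_chartDomain {V : Set X} (hV : IsOpen V) :
    IsDomain halfSpace (chartDomain e V) where
  uniqueDiffOn := (𝓡∂ 4).uniqueDiffOn
  subset_closure := (𝓡∂ 4).range_subset_closure_interior
  subset := inter_subset_left.trans e.extend_target_subset_range
  mem_nhdsWithin y hy := by
    refine Filter.inter_mem (target_mem_nhdsWithin hy.1) ?_
    have h1 : ContinuousWithinAt (e.extend (𝓡∂ 4)).symm halfSpace y :=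
      (e.continuousAt_extend_symm' hy.1).continuousWithinAt
    exact h1.preimage_mem_nhdsWithin (hV.mem_nhds hy.2)

omit [ChartedSpace (EuclideanHalfSpace 4) X] [IsManifold (𝓡∂ 4) ∞ X] in
lemma extend_mem_chartDomain {p : X} {V : Set X} (hp : p ∈ e.source) (hV : p ∈ V) :
    e.extend (𝓡∂ 4) p ∈ chartDomain e V := by
  have h1 : p ∈ (e.extend (𝓡∂ 4)).source := by simpa using hp
  exact ⟨(e.extend (𝓡∂ 4)).map_source h1, by
    rw [mem_preimage, (e.extend (𝓡∂ 4)).left_inv h1]; exact hV⟩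

/-- Interior points correspond to interior points in every chart. -/
lemma mem_interior_iff (he : IsChart X e) {y : EuclideanSpace ℝ (Fin 4)}
    (hy : y ∈ (e.extend (𝓡∂ 4)).target) :
    (e.extend (𝓡∂ 4)).symm y ∈ (𝓡∂ 4).interior X ↔ 0 < y 0 := by
  have hx := symm_mem_source hy
  set x := (e.extend (𝓡∂ 4)).symm y with hxdef
  have hy' : y = (𝓡∂ 4) (e x) := ((e.extend (𝓡∂ 4)).right_inv hy).symm
  have he1 : e.MDifferentiable (𝓡∂ 4) (𝓡∂ 4) :=
    ⟨(contMDiffOn_of_mem_maximalAtlas he).mdifferentiableOn (by simp),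
      (contMDiffOn_symm_of_mem_maximalAtlas he).mdifferentiableOn (by simp)⟩
  have h2 : (𝓡∂ 4).IsInteriorPoint (e x) ↔ 0 < y 0 := by
    change extChartAt (𝓡∂ 4) (e x) (e x) ∈ interior (range (𝓡∂ 4)) ↔ _
    rw [extChartAt_self_eq, ← hy', interior_range_modelWithCornersEuclideanHalfSpace]
    rfl
  rw [← h2]
  -- A map with surjective differential sends interior points to interior points; this is applied to
  -- the chart and to its inverse.
  constructor
  · intro h
    exact (he1.mdifferentiableAt hx).isInteriorPoint_of_surjective_mfderiv
      (he1.mfderiv_surjective hx) h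
  · intro h
    have h3 := e.map_source hx
    have := (he1.symm.mdifferentiableAt h3).isInteriorPoint_of_surjective_mfderiv
      (he1.symm.mfderiv_surjective h3) h
    rwa [e.left_inv hx] at this

lemma contDiffOn_coordFun (he : IsChart X e) {f : X → ℝ} {V : Set X}
    (hf : ContMDiffOn (𝓡∂ 4) 𝓘(ℝ, ℝ) ∞ f V) : ContDiffOn ℝ ∞ (coordFun e f) (chartDomain e V) := by
  rw [← contMDiffOn_iff_contDiffOn]
  have h1 := contMDiffOn_extend_symm he
  rw [← e.extend_target'] at h1
  exact hf.comp (h1.mono inter_subset_left) fun y hy => hy.2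

lemma contMDiffWithinAt_extend_symm (he : IsChart X e) {y : EuclideanSpace ℝ (Fin 4)}
    (hy : y ∈ (e.extend (𝓡∂ 4)).target) :
    ContMDiffWithinAt 𝓘(ℝ, EuclideanSpace ℝ (Fin 4)) (𝓡∂ 4) ∞ (e.extend (𝓡∂ 4)).symm halfSpace y := by
  have h1 := contMDiffOn_extend_symm he
  rw [← e.extend_target'] at h1
  exact (h1 y hy).mono_of_mem_nhdsWithin (target_mem_nhdsWithin hy)

/-- The field is the differential of the smooth inverse chart applied to a constant vector. -/
lemma contMDiffWithinAt_coordVec (he : IsChart X e) (i : Fin 4) {y : EuclideanSpace ℝ (Fin 4)}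
    (hy : y ∈ (e.extend (𝓡∂ 4)).target) :
    ContMDiffWithinAt 𝓘(ℝ, EuclideanSpace ℝ (Fin 4)) ((𝓡∂ 4).prod 𝓘(ℝ, EuclideanSpace ℝ (Fin 4))) ∞
      (fun z => Bundle.TotalSpace.mk' (EuclideanSpace ℝ (Fin 4))
        (E := fun x : X => TangentSpace (𝓡∂ 4) x) ((e.extend (𝓡∂ 4)).symm z) (coordVec e i z))
      halfSpace y := by
  have hf := contMDiffWithinAt_extend_symm he hy
  have h1 : IsManifold (𝓡∂ 4) 1 X := IsManifold.of_le (n := ∞) (by simp)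
  have hy' : y ∈ halfSpace := e.extend_target_subset_range hy
  have A := hf.mfderivWithin_const (m := ∞) (by simp) hy'
    (uniqueMDiffOn_iff_uniqueDiffOn.2 (𝓡∂ 4).uniqueDiffOn)
  have hv : ContMDiffWithinAt 𝓘(ℝ, EuclideanSpace ℝ (Fin 4))
      (𝓘(ℝ, EuclideanSpace ℝ (Fin 4)).prod 𝓘(ℝ, EuclideanSpace ℝ (Fin 4))) ∞
      (fun z => Bundle.TotalSpace.mk' (EuclideanSpace ℝ (Fin 4))
        (E := fun x : EuclideanSpace ℝ (Fin 4) => TangentSpace 𝓘(ℝ, EuclideanSpace ℝ (Fin 4)) x) z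
        (EuclideanSpace.single i (1 : ℝ) : EuclideanSpace ℝ (Fin 4))) halfSpace y :=
    contMDiffWithinAt_vectorSpace_iff_contDiffWithinAt.2 contDiffWithinAt_const
  exact ContMDiffWithinAt.clm_apply_of_inCoordinates A hv hf

lemma contDiffOn_coordMetric (he : IsChart X e) (g : SmoothMetric X) (i j : Fin 4) :
    ContDiffOn ℝ ∞ (fun y => coordMetric e g.inner y i j) (e.extend (𝓡∂ 4)).target := by
  intro y hy
  have hf := contMDiffWithinAt_extend_symm he hy
  have hg := (g.contMDiff.contMDiffAt (x := (e.extend (𝓡∂ 4)).symm y)).comp_contMDiffWithinAt y hf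
  have h2 : ContMDiffWithinAt 𝓘(ℝ, EuclideanSpace ℝ (Fin 4)) ((𝓡∂ 4).prod 𝓘(ℝ)) ∞
      (fun z => Bundle.TotalSpace.mk' ℝ (E := Bundle.Trivial X ℝ) ((e.extend (𝓡∂ 4)).symm z)
        (g.inner ((e.extend (𝓡∂ 4)).symm z) (coordVec e i z) (coordVec e j z))) halfSpace y :=
    ContMDiffWithinAt.clm_bundle_apply₂ (F₁ := EuclideanSpace ℝ (Fin 4))
      (F₂ := EuclideanSpace ℝ (Fin 4)) hg
      (contMDiffWithinAt_coordVec he i hy) (contMDiffWithinAt_coordVec he j hy)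
  rw [Bundle.contMDiffWithinAt_totalSpace] at h2
  exact (contMDiffWithinAt_iff_contDiffWithinAt.1 h2.2).mono e.extend_target_subset_range

/-- By the chain rule the differential of the chart is a left inverse. -/
lemma injective_mfderivWithin_extend_symm (he : IsChart X e) {y : EuclideanSpace ℝ (Fin 4)}
    (hy : y ∈ (e.extend (𝓡∂ 4)).target) : Function.Injective
      (mfderivWithin 𝓘(ℝ, EuclideanSpace ℝ (Fin 4)) (𝓡∂ 4) (e.extend (𝓡∂ 4)).symm halfSpace y) := by
  have h1 : UniqueMDiffWithinAt 𝓘(ℝ, EuclideanSpace ℝ (Fin 4)) halfSpace y :=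
    uniqueMDiffOn_iff_uniqueDiffOn.2 (𝓡∂ 4).uniqueDiffOn y (e.extend_target_subset_range hy)
  have h2 := (contMDiffWithinAt_extend_symm he hy).mdifferentiableWithinAt (by simp)
  have h3 := (e.contMDiffAt_extend (I := 𝓡∂ 4) (n := ∞) he
    (symm_mem_source hy)).mdifferentiableAt (by simp)
  have h4 := mfderiv_comp_mfderivWithin (I := 𝓘(ℝ, EuclideanSpace ℝ (Fin 4))) y h3 h2 h1
  have h5 : mfderivWithin 𝓘(ℝ, EuclideanSpace ℝ (Fin 4)) 𝓘(ℝ, EuclideanSpace ℝ (Fin 4))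
      (e.extend (𝓡∂ 4) ∘ (e.extend (𝓡∂ 4)).symm) halfSpace y = ContinuousLinearMap.id _ _ := by
    rw [← mfderivWithin_id h1]
    refine Filter.EventuallyEq.mfderivWithin_eq ?_ ((e.extend (𝓡∂ 4)).right_inv hy)
    exact Filter.eventuallyEq_of_mem (target_mem_nhdsWithin hy)
      fun z hz => (e.extend (𝓡∂ 4)).right_inv hz
  rw [h5] at h4
  intro a b hab
  have h6 := congrArg (fun L => L a) h4
  have h7 := congrArg (fun L => L b) h4
  simp only [ContinuousLinearMap.comp_apply, hab] at h6 h7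
  exact h6.trans h7.symm

omit [IsManifold (𝓡∂ 4) ∞ X] in
lemma coordMetric_apply_apply (g : BilinField X) (y : EuclideanSpace ℝ (Fin 4)) (v : Fin 4 → ℝ) :
    v ⬝ᵥ (coordMetric e g y).mulVec v = g ((e.extend (𝓡∂ 4)).symm y)
      (∑ i, v i • coordVec e i y) (∑ i, v i • coordVec e i y) := by
  simp only [dotProduct, Matrix.mulVec, map_sum, map_smul, Finset.mul_sum,
    sum_apply, smul_apply, coordMetric, Matrix.of_apply, smul_eq_mul]
  rw [Finset.sum_comm]
  exact Finset.sum_congr rfl fun i _ => Finset.sum_congr rfl fun j _ => by ring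

lemma map_toLp_eq_sum {F : Type*} [AddCommGroup F] [Module ℝ F] [TopologicalSpace F]
    (A : EuclideanSpace ℝ (Fin 4) →L[ℝ] F) (v : Fin 4 → ℝ) :
    A (WithLp.toLp 2 v) = ∑ i, v i • A (EuclideanSpace.single i 1) := by
  have h3 : (WithLp.toLp 2 v : EuclideanSpace ℝ (Fin 4)) =
      ∑ i, v i • EuclideanSpace.single i (1 : ℝ) := by
    ext j; simp [Pi.single_apply]
  rw [h3, map_sum]
  exact Finset.sum_congr rfl fun i _ => map_smul _ _ _

lemma isSmoothMetricOn_coordMetric (he : IsChart X e) (g : SmoothMetric X) (V : Set X) :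
    IsSmoothMetricOn (chartDomain e V) (coordMetric e g.inner) where
  smooth i j := (contDiffOn_coordMetric he g i j).mono inter_subset_left
  symm y _ := by
    ext i j
    exact g.symm _ _ _
  det_ne_zero y hy hdet := by
    -- A kernel vector would give a null vector of a positive definite form; it is nonzero since the
    -- coordinate fields are independent.
    obtain ⟨v, hv, hv0⟩ := Matrix.exists_mulVec_eq_zero_iff.2 hdet
    have h1 := coordMetric_apply_apply (e := e) g.inner y v
    rw [hv0, dotProduct_zero] at h1
    refine (g.pos _ (∑ i, v i • coordVec e i y) fun h0 => hv ?_).ne h1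
    have h2 : mfderivWithin 𝓘(ℝ, EuclideanSpace ℝ (Fin 4)) (𝓡∂ 4) (e.extend (𝓡∂ 4)).symm halfSpace y
        (WithLp.toLp 2 v : EuclideanSpace ℝ (Fin 4)) = 0 := by
      exact (map_toLp_eq_sum _ v).trans h0
    have h4 := injective_mfderivWithin_extend_symm he hy.1 (h2.trans (map_zero _).symm)
    funext i
    exact congrArg (fun z : EuclideanSpace ℝ (Fin 4) => z i) h4

end Chart

end FGCompact

/-! ### Boundary calculus in the half-space -/

namespace FGCompact

section BoundaryCalculus

open Topology

variable {T T' : Set (EuclideanSpace ℝ (Fin 4))} {y : EuclideanSpace ℝ (Fin 4)}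

lemma mem_halfSpace_iff : y ∈ halfSpace ↔ 0 ≤ y 0 := by
  rw [halfSpace, range_modelWithCornersEuclideanHalfSpace]; rfl

/-- Tangential derivatives of a function which vanishes on the boundary. -/
lemma pd_succ_eq_zero (hT : IsDomain halfSpace T) {f : EuclideanSpace ℝ (Fin 4) → ℝ}
    (hf : ContDiffOn ℝ ∞ f T) (h0 : ∀ z ∈ T, z 0 = 0 → f z = 0) (hy : y ∈ T) (hy0 : y 0 = 0)
    (α : Fin 3) : pd halfSpace α.succ f y = 0 := by
  have h1 := (hT.differentiableWithinAt hf hy).hasFDerivWithinAt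
  -- This line stays in the boundary for both signs of `t`, so `f ∘ c` vanishes near `0` and has an
  -- ordinary derivative.
  let c : ℝ → EuclideanSpace ℝ (Fin 4) := fun t => y + t • EuclideanSpace.single α.succ (1 : ℝ)
  have hc0 : ∀ t, (c t) 0 = 0 := by
    intro t; simp [c, hy0]
  have hcS : ∀ t, c t ∈ halfSpace := fun t => mem_halfSpace_iff.2 (hc0 t).ge
  have hc : HasDerivAt c (EuclideanSpace.single α.succ (1 : ℝ)) 0 := by
    simpa [c] using ((hasDerivAt_id (0 : ℝ)).smul_const
      (EuclideanSpace.single α.succ (1 : ℝ) : EuclideanSpace ℝ (Fin 4))).const_add y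
  have hcy : c 0 = y := by simp [c]
  rw [← hcy] at h1
  have h2 := h1.comp_hasDerivWithinAt 0 (hc.hasDerivWithinAt (s := univ)) (fun t _ => hcS t)
  rw [hasDerivWithinAt_univ] at h2
  have hev : ∀ᶠ t in 𝓝 (0 : ℝ), c t ∈ T := by
    have h3 : Filter.Tendsto c (𝓝 0) (𝓝[halfSpace] y) :=
      tendsto_nhdsWithin_iff.2 ⟨hcy ▸ hc.continuousAt, Filter.Eventually.of_forall hcS⟩
    exact h3 (hT.mem_nhdsWithin y hy)
  have h4 : (f ∘ c) =ᶠ[𝓝 0] fun _ => 0 := hev.mono fun t ht => h0 _ ht (hc0 t)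
  have h5 := (h2.congr_of_eventuallyEq h4.symm).unique (hasDerivAt_const 0 0)
  rw [hcy] at h5
  exact h5

/-- `f` has a local minimum at `y` and `∂₀` points into the half-space. For `f = r` this decides the
sign of the normal. -/
lemma pd_zero_nonneg (hT : IsDomain halfSpace T) {f : EuclideanSpace ℝ (Fin 4) → ℝ}
    (h0 : ∀ z ∈ T, 0 ≤ f z) (hy : y ∈ T) (hfy : f y = 0) : 0 ≤ pd halfSpace 0 f y := by
  have h1 : IsLocalMinOn f halfSpace y :=
    Filter.mem_of_superset (hT.mem_nhdsWithin y hy) fun z hz => by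
      simpa [hfy] using h0 z hz
  refine h1.fderivWithin_nonneg (mem_posTangentConeAt_of_segment_subset ?_)
  have h2 := mem_halfSpace_iff.1 (hT.subset hy)
  have hconv : Convex ℝ halfSpace := (𝓡∂ 4).convex_range
  refine hconv.segment_subset (hT.subset hy) (mem_halfSpace_iff.2 ?_)
  simp; linarith

/-- The Christoffel symbols of a conformal metric at a point where the conformal factor is
stationary. -/
lemma christoffel_conformal {S : Set (EuclideanSpace ℝ (Fin 4))} (hT : IsDomain S T)
    {G G' : EuclideanSpace ℝ (Fin 4) → Matrix (Fin 4) (Fin 4) ℝ} (hG : IsSmoothMetricOn T G)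
    {u : EuclideanSpace ℝ (Fin 4) → ℝ} (hu : ContDiffOn ℝ ∞ u T)
    (hs : ∀ y ∈ T, G' y = Real.exp (2 * u y) • G y) (hy : y ∈ T) (hdu : ∀ i, pd S i u y = 0)
    (k i j : Fin 4) : christoffel S G' k i j y = christoffel S G k i j y := by
  obtain ⟨g, I, hr, h⟩ := exists_repMetric hT hG.smooth hG.det_ne_zero hG.symm
  have ru := rep_toSmooth hu
  obtain ⟨e, e', re, -, hee, heu⟩ := exists_exp hT ru
  have h1 := (hr.conformal re hee hs).christoffel hT k i j
  rw [h.chr_conformal hee heu] at h1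
  have h2 := h1.evalAt_eq ⟨y, hy⟩
  have h3 : ∀ i, evalAt ⟨y, hy⟩ (pdDeriv hT i (toSmooth u hu)) = 0 := fun i => by
    rw [(ru.pd hT i).evalAt_eq, hdu]
  have h4 : ∀ (p : Prop) [Decidable p] (a : SmoothRing T), evalAt ⟨y, hy⟩ a = 0 →
      evalAt ⟨y, hy⟩ (if p then a else 0) = 0 := fun p _ a ha => by split_ifs <;> simp [ha]
  have h5 : evalAt ⟨y, hy⟩ (Alg.sharp I (fun i => pdDeriv hT i (toSmooth u hu)) k) = 0 := by
    simp [Alg.sharp, h3]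
  rw [map_add, map_sub, map_add, map_mul, h4 _ _ (h3 _), h4 _ _ (h3 _), h5,
    (hr.christoffel hT k i j).evalAt_eq] at h2
  simpa using h2.symm

variable {Gb Gp Gs : EuclideanSpace ℝ (Fin 4) → Matrix (Fin 4) (Fin 4) ℝ}
  {r : EuclideanSpace ℝ (Fin 4) → ℝ}

/-- The second fundamental form in terms of Christoffel symbols. -/
lemma secondForm_apply {G : EuclideanSpace ℝ (Fin 4) → Matrix (Fin 4) (Fin 4) ℝ}
    (hdet : (G y).det ≠ 0) (hsymm : (G y).IsSymm) (α β : Fin 3) :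
    secondForm G y α β =
      christoffel halfSpace G 0 α.succ β.succ y / Real.sqrt ((G y)⁻¹ 0 0) := by
  -- The lowered normal is a multiple of `dy⁰`, so only the upper index `0` contributes.
  have h1 : ∀ l, ∑ k, G y k l * (G y)⁻¹ k 0 = if l = 0 then 1 else 0 := by
    intro l
    have := congrFun (congrFun (Matrix.mul_nonsing_inv (G y) (isUnit_iff_ne_zero.2 hdet)) l) 0
    rw [Matrix.mul_apply, Matrix.one_apply] at this
    rw [← this]
    exact Finset.sum_congr rfl fun k _ => by rw [hsymm.apply]
  simp only [secondForm, Matrix.of_apply, outNormal]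
  rw [Finset.sum_comm]
  have h2 : ∀ l, ∑ k, G y k l * (-(G y)⁻¹ k 0 / Real.sqrt ((G y)⁻¹ 0 0)) *
      christoffel halfSpace G l α.succ β.succ y = -(if l = 0 then 1 else 0) *
        (christoffel halfSpace G l α.succ β.succ y / Real.sqrt ((G y)⁻¹ 0 0)) := by
    intro l
    rw [← h1, ← Finset.sum_neg_distrib, Finset.sum_mul]
    exact Finset.sum_congr rfl fun k _ => by ring
  simp [h2]

/-- The vanishing of the `T`-curvature terms which involve the second fundamental form. -/
lemma tCurv_of_secondForm {G : EuclideanSpace ℝ (Fin 4) → Matrix (Fin 4) (Fin 4) ℝ}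
    (hT : IsDomain halfSpace T) (hy : y ∈ T) (hy0 : y 0 = 0)
    (hL : ∀ z ∈ T, z 0 = 0 → secondForm G z = 0) :
    tCurv G y = (1 / 12) * normalDeriv G (scalarCurv halfSpace G) y := by
  have hS : ∀ z ∈ T, z 0 = 0 → shapeOp G z = 0 := fun z hz hz0 => by
    rw [shapeOp, hL z hz hz0, mul_zero]
  have hH : ∀ z ∈ T, z 0 = 0 → meanCurv G z = 0 := fun z hz hz0 => by
    rw [meanCurv, hS z hz hz0, Matrix.trace_zero]
  have hC : curvSecond G y = 0 := by
    simp [curvSecond, hL y hy hy0]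
  have hB : bdryLaplacianMeanCurv G y = 0 := by
    have hb : bdryIncl (tangCoord y) = y := by
      ext i
      refine Fin.cases ?_ (fun α => ?_) i
      · simp [bdryIncl, hy0]
      · simp [bdryIncl, tangCoord]
    have hcont : Continuous bdryIncl := by
      unfold bdryIncl
      refine (PiLp.continuous_toLp 2 _).comp (continuous_pi fun i => ?_)
      refine Fin.cases ?_ (fun α => ?_) i
      · simpa using continuous_const
      · simpa using PiLp.continuous_apply 2 _ α
    have hb0 : ∀ z, bdryIncl z 0 = 0 := fun z => by simp [bdryIncl]
    -- Vanishing of `L` at nearby boundary points is needed here, since `H` is differentiated.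
    have hev : (fun z => meanCurv G (bdryIncl z)) =ᶠ[𝓝 (tangCoord y)] fun _ => 0 := by
      have h3 : Filter.Tendsto bdryIncl (𝓝 (tangCoord y)) (𝓝[halfSpace] y) :=
        tendsto_nhdsWithin_iff.2 ⟨by simpa [hb] using hcont.tendsto (tangCoord y),
          Filter.Eventually.of_forall fun z => mem_halfSpace_iff.2 (hb0 z).ge⟩
      have h4 := h3 (hT.mem_nhdsWithin y hy)
      exact Filter.mem_of_superset h4 fun z hz => hH _ hz (hb0 z)
    have hpd : ∀ {f : EuclideanSpace ℝ (Fin 3) → ℝ}, f =ᶠ[𝓝 (tangCoord y)] (fun _ => 0) →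
        ∀ i, pd univ i f =ᶠ[𝓝 (tangCoord y)] fun _ => 0 := by
      intro f hf i
      filter_upwards [hf.eventuallyEq_nhds] with z hz
      have : f =ᶠ[𝓝[univ] z] fun _ => 0 := by rwa [nhdsWithin_univ]
      rw [pd, this.fderivWithin_eq hz.eq_of_nhds]
      simp
    rw [bdryLaplacianMeanCurv, laplacian]
    simp [fun i j => (hpd (hpd hev j) i).eq_of_nhds, fun k => (hpd hev k).eq_of_nhds]
  rw [tCurv, hC, hB, hH y hy hy0, hS y hy hy0]
  simp

namespace IsLocalCompactification

variable (h : IsLocalCompactification halfSpace T T' Gb Gp r)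
  (hr0 : ∀ z ∈ T, z 0 = 0 → r z = 0)
include h hr0

lemma pd_succ_r (hy : y ∈ T) (hy0 : y 0 = 0) (α : Fin 3) : pd halfSpace α.succ r y = 0 :=
  pd_succ_eq_zero h.domain h.smooth hr0 hy hy0 α

/-- Since `r` vanishes on the boundary, `dr` is there a multiple of `dy⁰`. -/
lemma gradPair_boundary (hy : y ∈ T) (hy0 : y 0 = 0) (f : EuclideanSpace ℝ (Fin 4) → ℝ) :
    gradPair halfSpace Gb r f y =
      pd halfSpace 0 r y * ∑ j, (Gb y)⁻¹ 0 j * pd halfSpace j f y := by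
  rw [gradPair, Fin.sum_univ_succ]
  simp only [h.pd_succ_r hr0 hy hy0, mul_zero, zero_mul, Finset.sum_const_zero, add_zero,
    Finset.mul_sum]
  exact Finset.sum_congr rfl fun _ _ => by ring

lemma norm_boundary (hy : y ∈ T) (hy0 : y 0 = 0) :
    pd halfSpace 0 r y ^ 2 * (Gb y)⁻¹ 0 0 = 1 := by
  have h1 := h.norm_diff y hy
  rw [h.gradPair_boundary hr0 hy hy0, Fin.sum_univ_succ] at h1
  simp only [h.pd_succ_r hr0 hy hy0, mul_zero, Finset.sum_const_zero, add_zero] at h1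
  linarith

/-- The boundary is totally geodesic for the compactified metric. -/
lemma christoffel_boundary (hy : y ∈ T) (hy0 : y 0 = 0) (α β : Fin 3) :
    christoffel halfSpace Gb 0 α.succ β.succ y = 0 := by
  have h1 := fun i j => h.einstein_eq hy i j
  simp only [hr0 y hy hy0, zero_mul, zero_add] at h1
  -- The trace of `2∇²r + (Δr) gbar = 0` is `6Δr = 0` in dimension four.
  have hlap : laplacian halfSpace Gb r y = 0 := by
    have hinv : ∑ i, ∑ j, (Gb y)⁻¹ i j * Gb y i j = 4 := by
      have h2 : ∀ i, ∑ j, (Gb y)⁻¹ i j * Gb y i j = 1 := fun i => by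
        have := congrFun (congrFun (Matrix.nonsing_inv_mul (Gb y)
          (isUnit_iff_ne_zero.2 (h.metric.det_ne_zero y hy))) i) i
        rw [Matrix.mul_apply, Matrix.one_apply_eq] at this
        rw [← this]
        exact Finset.sum_congr rfl fun j _ => by rw [(h.metric.symm y hy).apply]
      simp [h2]
    have h3 : 2 * laplacian halfSpace Gb r y
        + laplacian halfSpace Gb r y * ∑ i, ∑ j, (Gb y)⁻¹ i j * Gb y i j = 0 := by
      conv_lhs => enter [1, 2]; rw [laplacian]
      rw [Finset.mul_sum, Finset.mul_sum, ← Finset.sum_add_distrib]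
      refine Finset.sum_eq_zero fun i _ => ?_
      rw [Finset.mul_sum, Finset.mul_sum, ← Finset.sum_add_distrib]
      refine Finset.sum_eq_zero fun j _ => ?_
      linear_combination (Gb y)⁻¹ i j * h1 i j
    rw [hinv] at h3
    linarith
  have h4 := h1 α.succ β.succ
  -- `∂_β r` vanishes along the boundary, so the tangential Hessian reduces to `-Γ⁰ ∂₀r`, and `∂₀r ≠
  -- 0`.
  have h5 : pd halfSpace α.succ (pd halfSpace β.succ r) y = 0 :=
    pd_succ_eq_zero h.domain (h.domain.contDiffOn_pd h.smooth _)
      (fun z hz hz0 => h.pd_succ_r hr0 hz hz0 β) hy hy0 α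
  rw [hlap, h5, Fin.sum_univ_succ] at h4
  simp only [h.pd_succ_r hr0 hy hy0, mul_zero, Finset.sum_const_zero, add_zero, zero_mul] at h4
  have h6 := h.norm_boundary hr0 hy hy0
  have h7 : pd halfSpace 0 r y ≠ 0 := fun h8 => by simp [h8] at h6
  have h8 : christoffel halfSpace Gb 0 α.succ β.succ y * pd halfSpace 0 r y = 0 := by linarith
  exact (mul_eq_zero.1 h8).resolve_right h7

/-- With `|dr| = 1` and `r ≥ 0`, the gradient of `r` is the inward unit normal. -/
lemma normalDeriv_boundary (hr : ∀ z ∈ T, 0 ≤ r z) (hy : y ∈ T) (hy0 : y 0 = 0)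
    (hG : Gs y = Gb y) (f : EuclideanSpace ℝ (Fin 4) → ℝ) :
    normalDeriv Gs f y = -gradPair halfSpace Gb r f y := by
  have h1 := h.norm_boundary hr0 hy hy0
  have h2 : 0 ≤ pd halfSpace 0 r y := pd_zero_nonneg h.domain hr hy (hr0 y hy hy0)
  have h3 : pd halfSpace 0 r y ≠ 0 := fun h8 => by simp [h8] at h1
  have h4 : Real.sqrt ((Gb y)⁻¹ 0 0) = (pd halfSpace 0 r y)⁻¹ := by
    rw [show (Gb y)⁻¹ 0 0 = (pd halfSpace 0 r y)⁻¹ ^ 2 by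
      field_simp; linarith, Real.sqrt_sq (inv_nonneg.2 h2)]
  have h5 : ((Gb y)⁻¹).IsSymm := by
    rw [Matrix.IsSymm, Matrix.transpose_nonsing_inv, h.metric.symm y hy]
  rw [h.gradPair_boundary hr0 hy hy0, Finset.mul_sum, ← Finset.sum_neg_distrib]
  unfold normalDeriv outNormal
  rw [hG, h4]
  refine Finset.sum_congr rfl fun k _ => ?_
  rw [h5.apply 0 k, div_inv_eq_mul]; ring

/-- The conformal factor is stationary along the boundary. -/
lemma pd_conformal_factor {u A B : EuclideanSpace ℝ (Fin 4) → ℝ} (hA : ContDiffOn ℝ ∞ A T)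
    (hB : ContDiffOn ℝ ∞ B T) (hAB : ∀ y ∈ T, u y = A y + B y * r y ^ 3)
    (hA0 : ∀ z ∈ T, z 0 = 0 → A z = 0) (hy : y ∈ T) (hy0 : y 0 = 0)
    (hA1 : gradPair halfSpace Gb r A y = 0) (i : Fin 4) : pd halfSpace i u y = 0 := by
  -- Tangential derivatives vanish as `A = 0` on the boundary; the derivative along `∇r` then
  -- isolates `∂₀A`. The term `Br³` contributes nothing to first order.
  have hA2 : ∀ i, pd halfSpace i A y = 0 := by
    have h1 := pd_succ_eq_zero h.domain hA hA0 hy hy0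
    refine Fin.cases ?_ h1
    rw [h.gradPair_boundary hr0 hy hy0, Fin.sum_univ_succ] at hA1
    simp only [h1, mul_zero, Finset.sum_const_zero, add_zero] at hA1
    have h2 := h.norm_boundary hr0 hy hy0
    have h3 : pd halfSpace 0 r y ≠ 0 := fun h8 => by simp [h8] at h2
    have h4 : (Gb y)⁻¹ 0 0 ≠ 0 := fun h8 => by simp [h8] at h2
    simpa [h3, h4] using hA1
  have rr := rep_toSmooth h.smooth
  have rA := rep_toSmooth hA
  have rB := rep_toSmooth hB
  have h1 := (((rA.add (rB.mul (rr.pow 3))).congr fun y hy => (hAB y hy).symm).pd h.domain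
    i).evalAt_eq ⟨y, hy⟩
  rw [← h1]
  simp only [map_add, Derivation.leibniz, Derivation.leibniz_pow, smul_eq_mul, nsmul_eq_mul, map_mul,
    map_pow, (rA.pd h.domain i).evalAt_eq, hA2, rr.evalAt_eq, hr0 y hy hy0]
  simp

end IsLocalCompactification

end BoundaryCalculus

end FGCompact

namespace FGCompact

/-! ### The compactified metric -/

section Assembly

open Topology

lemma IsSmoothMetricOn.smul {T : Set (EuclideanSpace ℝ (Fin 4))}
    {G G' : EuclideanSpace ℝ (Fin 4) → Matrix (Fin 4) (Fin 4) ℝ} (h : IsSmoothMetricOn T G)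
    {f : EuclideanSpace ℝ (Fin 4) → ℝ} (hf : ContDiffOn ℝ ∞ f T) (hf0 : ∀ y ∈ T, f y ≠ 0)
    (hG' : ∀ y ∈ T, G' y = f y • G y) : IsSmoothMetricOn T G' where
  smooth i j := (hf.mul (h.smooth i j)).congr fun y hy => by
    rw [hG' y hy, Matrix.smul_apply, smul_eq_mul]
  det_ne_zero y hy := by
    rw [hG' y hy, Matrix.det_smul]
    exact mul_ne_zero (pow_ne_zero _ (hf0 y hy)) (h.det_ne_zero y hy)
  symm y hy := by
    rw [hG' y hy, Matrix.IsSymm, Matrix.transpose_smul, h.symm y hy]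

variable {X : Type*} [TopologicalSpace X] [ChartedSpace (EuclideanHalfSpace 4) X]
  [IsManifold (𝓡∂ 4) ∞ X] {e : OpenPartialHomeomorph X (EuclideanHalfSpace 4)}

omit [IsManifold (𝓡∂ 4) ∞ X] in
lemma coordMetric_smul {g g' : BilinField X} {c : ℝ} {y : EuclideanSpace ℝ (Fin 4)}
    (h : g' ((e.extend (𝓡∂ 4)).symm y) = c • g ((e.extend (𝓡∂ 4)).symm y)) :
    coordMetric e g' y = c • coordMetric e g y := by
  ext i j
  simp only [coordMetric, Matrix.of_apply, Matrix.smul_apply, h, smul_apply]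

lemma isOpen_interior : IsOpen ((𝓡∂ 4).interior X) :=
  (𝓡∂ 4).isOpen_interior (n := ∞) (by simp)

/-- The metric `e^{2u} g`. -/
def SmoothMetric.conformal (g : SmoothMetric X) (u : X → ℝ)
    (hu : ContMDiff (𝓡∂ 4) 𝓘(ℝ, ℝ) ∞ u) : SmoothMetric X where
  inner x := Real.exp (2 * u x) • g.inner x
  symm x v w := by
    simp only [smul_apply, g.symm x v w]
  pos x v hv := by
    simp only [smul_apply, smul_eq_mul]
    exact mul_pos (Real.exp_pos _) (g.pos x v hv)
  isVonNBounded x := by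
    -- The unit ball of `e^{2u} g` is `e^{-u}` times that of `g`.
    refine ((g.isVonNBounded x).image
      ((Real.exp (-u x)) • ContinuousLinearMap.id ℝ (TangentSpace (𝓡∂ 4) x))).subset ?_
    intro v hv
    refine ⟨Real.exp (u x) • v, ?_, ?_⟩
    · simp only [mem_ofPred_eq, smul_apply, smul_eq_mul, map_smul] at hv ⊢
      rwa [← mul_assoc, ← Real.exp_add, ← two_mul]
    · simp only [smul_apply, ContinuousLinearMap.id_apply]
      rw [smul_smul, ← Real.exp_add, neg_add_cancel, Real.exp_zero, one_smul]
  contMDiff := by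
    have h1 : ContMDiff (𝓡∂ 4) 𝓘(ℝ, ℝ) ∞ fun x => Real.exp (2 * u x) :=
      (Real.contDiff_exp.comp (contDiff_const.mul contDiff_id)).contMDiff.comp hu
    exact h1.smul_section g.contMDiff

section Interior

variable {gplus : BilinField X} {r w : X → ℝ} {gbar : SmoothMetric X}
  {y : EuclideanSpace ℝ (Fin 4)}

lemma isSmoothMetricOn_interior (he : IsChart X e) (hr : IsDefiningFunction r)
    (hc : IsCompactification gplus r gbar) :
    IsSmoothMetricOn (chartDomain e ((𝓡∂ 4).interior X)) (coordMetric e gplus) := by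
  have hr1 : ContDiffOn ℝ ∞ (coordFun e r) (chartDomain e ((𝓡∂ 4).interior X)) :=
    contDiffOn_coordFun he hr.smooth.contMDiffOn
  have hr2 : ∀ y ∈ chartDomain e ((𝓡∂ 4).interior X), coordFun e r y ^ 2 ≠ 0 := fun y hy =>
    pow_ne_zero 2 (hr.pos _ hy.2).ne'
  refine (isSmoothMetricOn_coordMetric he gbar _).smul ((hr1.pow 2).inv hr2)
    (fun y hy => inv_ne_zero (hr2 y hy)) fun y hy => ?_
  rw [coordMetric_smul (c := coordFun e r y ^ 2) (hc _ hy.2), smul_smul, Pi.inv_apply,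
    inv_mul_cancel₀ (hr2 y hy), one_smul]

lemma ricci_eq (he : IsChart X e) (h : IsCCE gplus)
    (hy : y ∈ chartDomain e ((𝓡∂ 4).interior X)) (i j : Fin 4) :
    ricci halfSpace (coordMetric e gplus) i j y = -3 * coordMetric e gplus y i j := by
  have := h.einstein _ hy.2 e he (symm_mem_source hy.1) i j
  rwa [(e.extend (𝓡∂ 4)).right_inv hy.1] at this

lemma laplacian_eq (he : IsChart X e) (h : SolvesFG gplus w)
    (hy : y ∈ chartDomain e ((𝓡∂ 4).interior X)) :
    -laplacian halfSpace (coordMetric e gplus) (coordFun e w) y = 3 := by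
  have := h.eqn _ hy.2 e he (symm_mem_source hy.1)
  rwa [(e.extend (𝓡∂ 4)).right_inv hy.1] at this

/-- Agreement of `g` with `e^{2w} g⁺` is required only in the interior, so this covers both
`conformal w gplus` and its smooth extension. -/
lemma qCurv_eq_zero_of_interior (he : IsChart X e) (hCCE : IsCCE gplus)
    (hr : IsDefiningFunction r) (hc : IsCompactification gplus r gbar) (hw : SolvesFG gplus w)
    {g : BilinField X} (hg : ∀ x ∈ (𝓡∂ 4).interior X, g x = conformal w gplus x)
    (hy : y ∈ chartDomain e ((𝓡∂ 4).interior X)) : qCurv (coordMetric e g) y = 0 :=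
  qCurv_eq_zero (isDomain_chartDomain isOpen_interior) (isSmoothMetricOn_interior he hr hc)
    (contDiffOn_coordFun he hw.smooth) (fun _ hz => ricci_eq he hCCE hz)
    (fun _ hz => laplacian_eq he hw hz) (fun _ hz => coordMetric_smul (hg _ hz.2)) hy

end Interior

/-- The half-space lies in the closure of its interior, and this localises to relatively open sets.
-/
lemma chartDomain_subset_closure (he : IsChart X e) {V : Set X} (hV : IsOpen V) :
    chartDomain e V ⊆ closure (chartDomain e (V ∩ (𝓡∂ 4).interior X)) := by
  intro y hy
  have hT := isDomain_chartDomain (e := e) hV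
  have h1 := hT.subset_closure (hT.subset hy)
  have h2 : y ∈ closure (chartDomain e V ∩ interior halfSpace) := by
    rw [mem_closure_iff_nhdsWithin_neBot] at h1 ⊢
    rw [nhdsWithin_inter_of_mem]
    · exact h1
    · exact nhdsWithin_mono _ interior_subset (hT.mem_nhdsWithin y hy)
  refine closure_mono ?_ h2
  intro z hz
  refine ⟨hz.1.1, hz.1.2, (mem_interior_iff he hz.1.1).2 ?_⟩
  have h3 := hz.2
  rw [halfSpace, interior_range_modelWithCornersEuclideanHalfSpace] at h3
  exact h3

lemma mem_boundary_iff (he : IsChart X e) {y : EuclideanSpace ℝ (Fin 4)}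
    (hy : y ∈ (e.extend (𝓡∂ 4)).target) :
    (e.extend (𝓡∂ 4)).symm y ∈ (𝓡∂ 4).boundary X ↔ y 0 = 0 := by
  rw [← (𝓡∂ 4).compl_interior, mem_compl_iff, mem_interior_iff he hy]
  have := mem_halfSpace_iff.1 (e.extend_target_subset_range hy)
  exact ⟨fun h => le_antisymm (not_lt.1 h) this, fun h => h.not_gt⟩

omit [IsManifold (𝓡∂ 4) ∞ X] in
lemma IsDefiningFunction.nonneg {r : X → ℝ} (hr : IsDefiningFunction r) (x : X) : 0 ≤ r x := by
  by_cases hx : x ∈ (𝓡∂ 4).interior X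
  · exact (hr.pos x hx).le
  · rw [← mem_compl_iff, (𝓡∂ 4).compl_interior] at hx
    exact (hr.zero x hx).ge

open Classical in
/-- The function `w - log r`, extended by zero to the boundary. -/
def conformalFactor (r w : X → ℝ) (x : X) : ℝ :=
  if x ∈ (𝓡∂ 4).interior X then w x - Real.log (r x) else 0

section Expansion

variable {gplus : BilinField X} {r w A B : X → ℝ} {gbar : SmoothMetric X} {U : Set X}

omit [IsManifold (𝓡∂ 4) ∞ X] in
lemma conformalFactor_eq (hr : IsDefiningFunction r) (hA : ∀ x ∈ (𝓡∂ 4).boundary X, A x = 0)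
    (hU : ∀ x ∈ U ∩ (𝓡∂ 4).interior X, w x = Real.log (r x) + A x + B x * r x ^ 3) {x : X}
    (hx : x ∈ U) : conformalFactor r w x = A x + B x * r x ^ 3 := by
  unfold conformalFactor
  split_ifs with h
  · rw [hU x ⟨hx, h⟩]; ring
  · rw [← mem_compl_iff, (𝓡∂ 4).compl_interior] at h
    rw [hA x h, hr.zero x h]; simp

/-- Two open sets cover `X`: the interior, where `w - log r` is smooth, and `U`, where the factor
equals `A + Br³` even on the boundary because `A` and `r` vanish there. -/
lemma contMDiff_conformalFactor (hr : IsDefiningFunction r) (hw : SolvesFG gplus w)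
    (h : HasExpansion gbar r w A B) : ContMDiff (𝓡∂ 4) 𝓘(ℝ, ℝ) ∞ (conformalFactor r w) := by
  obtain ⟨U, hU, hMU, hA, hB, hAB⟩ := h.expansion
  have h1 : ContMDiffOn (𝓡∂ 4) 𝓘(ℝ, ℝ) ∞ (conformalFactor r w) ((𝓡∂ 4).interior X) := by
    have hlog : ContMDiffOn (𝓡∂ 4) 𝓘(ℝ, ℝ) ∞ (fun x => Real.log (r x)) ((𝓡∂ 4).interior X) := by
      have hl : ContMDiffOn 𝓘(ℝ, ℝ) 𝓘(ℝ, ℝ) ∞ Real.log {0}ᶜ := Real.contDiffOn_log.contMDiffOn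
      exact hl.comp hr.smooth.contMDiffOn fun x hx => (hr.pos x hx).ne'
    exact (hw.smooth.sub hlog).congr fun x hx => if_pos hx
  have h2 : ContMDiffOn (𝓡∂ 4) 𝓘(ℝ, ℝ) ∞ (conformalFactor r w) U := by
    refine (hA.add (hB.mul (hr.smooth.contMDiffOn.pow 3))).congr fun x hx => ?_
    exact conformalFactor_eq hr h.zero_A hAB hx
  refine contMDiff_of_contMDiffOn_union_of_isOpen h1 h2 ?_ isOpen_interior hU
  refine eq_univ_of_univ_subset ?_
  rw [← (𝓡∂ 4).interior_union_boundary_eq_univ (M := X)]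
  exact union_subset_union_right _ hMU

lemma exp_conformalFactor_smul (hr : IsDefiningFunction r) (hc : IsCompactification gplus r gbar)
    {x : X} (hx : x ∈ (𝓡∂ 4).interior X) :
    Real.exp (2 * conformalFactor r w x) • gbar.inner x = conformal w gplus x := by
  have h0 := hr.pos x hx
  rw [hc x hx, smul_smul, conformal, conformalFactor, if_pos hx]
  congr 1
  rw [← Real.exp_log (pow_pos h0 2), ← Real.exp_add, Real.log_pow]
  push_cast; ring_nf

lemma isLocalCompactification (he : IsChart X e) (hCCE : IsCCE gplus)
    (hr : IsDefiningFunction r) (hc : IsCompactification gplus r gbar) {V : Set X} (hV : IsOpen V)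
    (hV1 : ∀ p ∈ V, ∀ e, IsChart X e → p ∈ e.source →
      gradPair halfSpace (coordMetric e gbar.inner) (coordFun e r) (coordFun e r)
        (e.extend (𝓡∂ 4) p) = 1) :
    IsLocalCompactification halfSpace (chartDomain e V)
      (chartDomain e (V ∩ (𝓡∂ 4).interior X)) (coordMetric e gbar.inner) (coordMetric e gplus)
      (coordFun e r) where
  domain := isDomain_chartDomain hV
  domain' := isDomain_chartDomain (hV.inter isOpen_interior)
  subset _ hy := ⟨hy.1, hy.2.1⟩
  subset_closure := chartDomain_subset_closure he hV
  metric := isSmoothMetricOn_coordMetric he gbar V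
  smooth := contDiffOn_coordFun he hr.smooth.contMDiffOn
  pos _ hy := hr.pos _ hy.2.2
  norm_diff y hy := by
    have := hV1 _ hy.2 e he (symm_mem_source hy.1)
    rwa [(e.extend (𝓡∂ 4)).right_inv hy.1] at this
  compact _ hy := coordMetric_smul (hc _ hy.2.2)
  einstein _ hy := ricci_eq he hCCE ⟨hy.1, hy.2.2⟩

/-- The boundary geometry of the metric `e^{2w} g⁺`. -/
lemma boundary_geometry (hCCE : IsCCE gplus) (hr : IsGeodesicDefiningFunction gplus r gbar)
    (hw : SolvesFG gplus w) (h : HasExpansion gbar r w A B) {g : SmoothMetric X}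
    (hg : ∀ x, g.inner x = Real.exp (2 * conformalFactor r w x) • gbar.inner x)
    (he : IsChart X e) {p : X} (hp : p ∈ (𝓡∂ 4).boundary X) (hpe : p ∈ e.source) :
    secondForm (coordMetric e g.inner) (e.extend (𝓡∂ 4) p) = 0 ∧
      normalDerivScalarAt e g.inner p = 36 * B p ∧
      tCurvAt e g.inner p = (1 / 12) * normalDerivScalarAt e g.inner p := by
  have hr' := hr.defining
  obtain ⟨U, hU, hMU, hA, hB, hAB⟩ := h.expansion
  obtain ⟨U', hU', hMU', hr1⟩ := hr.norm_diff
  have hV := hU.inter hU'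
  have H := isLocalCompactification he hCCE hr' hr.compactification hV
    fun p hp => hr1 p hp.2
  have hbd : ∀ z ∈ chartDomain e (U ∩ U'), z 0 = 0 →
      (e.extend (𝓡∂ 4)).symm z ∈ (𝓡∂ 4).boundary X :=
    fun z hz hz0 => (mem_boundary_iff he hz.1).2 hz0
  have hr0 : ∀ z ∈ chartDomain e (U ∩ U'), z 0 = 0 → coordFun e r z = 0 :=
    fun z hz hz0 => hr'.zero _ (hbd z hz hz0)
  have hA0 : ∀ z ∈ chartDomain e (U ∩ U'), z 0 = 0 → coordFun e A z = 0 :=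
    fun z hz hz0 => h.zero_A _ (hbd z hz hz0)
  have hu : ContDiffOn ℝ ∞ (coordFun e (conformalFactor r w)) (chartDomain e (U ∩ U')) :=
    contDiffOn_coordFun he (contMDiff_conformalFactor hr' hw h).contMDiffOn
  have hA' : ContDiffOn ℝ ∞ (coordFun e A) (chartDomain e (U ∩ U')) :=
    contDiffOn_coordFun he (hA.mono inter_subset_left)
  have hB' : ContDiffOn ℝ ∞ (coordFun e B) (chartDomain e (U ∩ U')) :=
    contDiffOn_coordFun he (hB.mono inter_subset_left)
  have huAB : ∀ z ∈ chartDomain e (U ∩ U'), coordFun e (conformalFactor r w) z =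
      coordFun e A z + coordFun e B z * coordFun e r z ^ 3 :=
    fun z hz => conformalFactor_eq hr' h.zero_A hAB hz.2.1
  have hs : ∀ z ∈ chartDomain e (U ∩ U'), coordMetric e g.inner z =
      Real.exp (2 * coordFun e (conformalFactor r w) z) • coordMetric e gbar.inner z :=
    fun z _ => coordMetric_smul (hg _)
  have heven : ∀ z ∈ chartDomain e (U ∩ U'), z 0 = 0 → ∀ k : ℕ,
      (gradPair halfSpace (coordMetric e gbar.inner) (coordFun e r))^[2 * k + 1]
        (coordFun e A) z = 0 := fun z hz hz0 k => by
    have := h.even_A _ (hbd z hz hz0) e he (symm_mem_source hz.1) k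
    rwa [(e.extend (𝓡∂ 4)).right_inv hz.1] at this
  -- Index `0` of `heven` is the first derivative of `A`; index `1`, used below for `∂R/∂n`, is the
  -- third.
  have hdu : ∀ z ∈ chartDomain e (U ∩ U'), z 0 = 0 → ∀ i,
      pd halfSpace i (coordFun e (conformalFactor r w)) z = 0 := fun z hz hz0 =>
    H.pd_conformal_factor hr0 hA' hB' huAB hA0 hz hz0 (heven z hz hz0 0)
  have hgs := isSmoothMetricOn_coordMetric he g (U ∩ U')
  have hL : ∀ z ∈ chartDomain e (U ∩ U'), z 0 = 0 → secondForm (coordMetric e g.inner) z = 0 := by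
    intro z hz hz0
    ext α β
    rw [secondForm_apply (hgs.det_ne_zero z hz) (hgs.symm z hz),
      christoffel_conformal H.domain H.metric hu hs hz (hdu z hz hz0),
      H.christoffel_boundary hr0 hz hz0, zero_div, Matrix.zero_apply]
  have hy : e.extend (𝓡∂ 4) p ∈ chartDomain e (U ∩ U') :=
    extend_mem_chartDomain hpe ⟨hMU hp, hMU' hp⟩
  have hyp : (e.extend (𝓡∂ 4)).symm (e.extend (𝓡∂ 4) p) = p := e.extend_left_inv hpe
  have hy0 : (e.extend (𝓡∂ 4) p) 0 = 0 := (mem_boundary_iff he hy.1).1 (by rwa [hyp])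
  have hu0 : coordFun e (conformalFactor r w) (e.extend (𝓡∂ 4) p) = 0 := by
    rw [huAB _ hy, hA0 _ hy hy0, hr0 _ hy hy0]; simp
  refine ⟨hL _ hy hy0, ?_, tCurv_of_secondForm H.domain hy hy0 hL⟩
  have h1 := H.gradPair_scalarCurv (contDiffOn_coordFun he (hw.smooth.mono inter_subset_right)) hu
    (fun z hz => ?_) (fun z hz => laplacian_eq he hw ⟨hz.1, hz.2.2⟩) hs hA' hB' huAB hy
    (hr0 _ hy hy0) hu0 (hdu _ hy hy0) (heven _ hy hy0 1)
  · rw [normalDerivScalarAt, H.normalDeriv_boundary hr0 (fun z _ => hr'.nonneg _) hy hy0 ?_, h1,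
      coordFun, hyp]
    · ring
    · rw [hs _ hy, hu0]; simp
  · have h2 := hz.2.2
    simp only [coordFun, conformalFactor, if_pos h2]
    ring

end Expansion

end Assembly

end FGCompact

end

/-! ### The theorem -/

open FGCompact in
theorem mainTheorem10 {X : Type*} [TopologicalSpace X] [T2Space X] [CompactSpace X]
    [ChartedSpace (EuclideanHalfSpace 4) X] [IsManifold (𝓡∂ 4) ∞ X]
    (gplus : BilinField X) (hCCE : IsCCE gplus)
    (r : X → ℝ) (gbar : SmoothMetric X) (hr : IsGeodesicDefiningFunction gplus r gbar)
    (w : X → ℝ) (hw : SolvesFG gplus w) :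
    (∀ p ∈ (𝓡∂ 4).interior X, ∀ e, IsChart X e → p ∈ e.source →
      qCurvAt e (conformal w gplus) p = 0) ∧
    ∀ A B : X → ℝ, HasExpansion gbar r w A B →
      ∃ gstar : SmoothMetric X,
        (∀ x ∈ (𝓡∂ 4).interior X, gstar.inner x = conformal w gplus x) ∧
        TotallyGeodesicBoundary gstar ∧
        (∀ p : X, ∀ e, IsChart X e → p ∈ e.source → qCurvAt e gstar.inner p = 0) ∧
        (∀ p ∈ (𝓡∂ 4).boundary X, ∀ e, IsChart X e → p ∈ e.source →
          B p = (1 / 36) * normalDerivScalarAt e gstar.inner p ∧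
          (1 / 36) * normalDerivScalarAt e gstar.inner p = (1 / 3) * tCurvAt e gstar.inner p) := by
  have hr' := hr.defining
  have hc := hr.compactification
  refine ⟨fun p hp e he hpe => qCurv_eq_zero_of_interior he hCCE hr' hc hw (fun _ _ => rfl)
    (extend_mem_chartDomain hpe hp), fun A B h => ?_⟩
  have hg : ∀ x ∈ (𝓡∂ 4).interior X,
      (SmoothMetric.conformal gbar _ (contMDiff_conformalFactor hr' hw h)).inner x =
        conformal w gplus x := fun x hx => exp_conformalFactor_smul hr' hc hx
  refine ⟨SmoothMetric.conformal gbar _ (contMDiff_conformalFactor hr' hw h), hg,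
    fun p hp e he hpe => (boundary_geometry hCCE hr hw h (g := SmoothMetric.conformal gbar _
      (contMDiff_conformalFactor hr' hw h)) (fun _ => rfl) he hp hpe).1,
    fun p e he hpe => ?_, fun p hp e he hpe => ?_⟩
  -- `Q` is continuous on the whole chart and zero on the dense set of interior points.
  · have hT := isDomain_chartDomain (e := e) isOpen_univ
    have h1 : ContinuousOn _ _ := (contDiffOn_qCurv hT (isSmoothMetricOn_coordMetric he
      (SmoothMetric.conformal gbar _ (contMDiff_conformalFactor hr' hw h)) univ)).continuousOn
    have h2 : EqOn (qCurv (coordMetric e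
        (SmoothMetric.conformal gbar _ (contMDiff_conformalFactor hr' hw h)).inner))
        (fun _ => 0) (chartDomain e (univ ∩ (𝓡∂ 4).interior X)) := fun y hy =>
      qCurv_eq_zero_of_interior he hCCE hr' hc hw hg ⟨hy.1, hy.2.2⟩
    exact h2.of_subset_closure h1 continuousOn_const (fun y hy => ⟨hy.1, hy.2.1⟩)
      (chartDomain_subset_closure he isOpen_univ) (extend_mem_chartDomain hpe (mem_univ p))
  · obtain ⟨-, h1, h2⟩ := boundary_geometry hCCE hr hw h (g := SmoothMetric.conformal gbar _
      (contMDiff_conformalFactor hr' hw h)) (fun _ => rfl) he hp hpe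
    rw [h2]
    exact ⟨by rw [h1]; ring, by ring⟩
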